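/- Let $\Phi_F>0$ and let $K\in C^2(\mathbb R)$ have bounded $K'$ and $K''$ on $\mathbb R$ and satisfy $K(\phi)>0$ for $\phi\in[0,\Phi_F]$. Put $$k_{\min}:=K'(0)+\int_0^{\Phi_F}\min(K''(\phi),0)\,d\phi .$$ Let $Q_{\mathrm{init}}\in C^1[0,1]$ be increasing (i.e. non-decreasing) with $Q_{\mathrm{init}}(0)=0$, $Q_{\mathrm{init}}(1)=\Phi_F$ and $Q_{\mathrm{init}}'(1)>K(\Phi_F)$. For $0<T\le+\infty$, a classical solution on $[0,T)$ with initial datum $Q_{\mathrm{init}}$ is a pair $(Q,N)$ such that $Q\in C^1([0,T)\times[0,1])$ is increasing in $\eta$, $N\in C[0,T)$ is positive, and for $\tau\in[0,T)$ $$\partial_\tau Q+\partial_\eta Q=\frac1{N(\tau)}+K(Q)\quad(\eta\in(0,1)),\qquad Q(\tau,0)=0,\qquad \frac1{N(\tau)}=\partial_\eta Q(\tau,1)-K(\Phi_F),$$ $Q(0,\eta)=Q_{\mathrm{init}}(\eta)$ for $\eta\in[0,1]$, and $K(\Phi_F)<\partial_\eta Q(\tau,1)<+\infty$. A steady state is a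 time-independent pair $(Q^*,N^*)$ that is a classical solution on $[0,+\infty)$ (with initial datum $Q^*$). A classical solution $(Q,N)$ on $[0,T)$ blows up in finite time if the maximal existence time $\tau^*$ for its initial datum (the largest $T'$ such that a classical solution with this datum exists on $[0,T')$) is finite, $(Q,N)$ is the restriction to $[0,T)$ of a classical solution $(\bar Q,\bar N)$ on $[0,\tau^*)$, and $\bar N(\tau)\to+\infty$ as $\tau\to(\tau^*)^-$. **Theorem.** Suppose $k_{\min}>0$. Then there is at most one steady state, and a classical solution $(Q,N)$ on any $[0,T)$, $0<T\le+\infty$, blows up in finite time if and only if it is not the steady state, i.e. unless a steady state $(Q^*,N^*)$ exists and $Q(\tau,\cdot)=Q^*$, $N(\tau)=N^*$ for all $\tau\in[0,T)$. -/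

import Mathlib

open Set Filter Topology

noncomputable section

namespace PulseCoupled

/-- The time interval `[0, T)`, where `0 < T ≤ +∞` is an extended real number. -/
def timeInterval (T : EReal) : Set ℝ := {τ : ℝ | 0 ≤ τ ∧ (τ : EReal) < T}

/-- Standing assumption on the phase response function: `K ∈ C²(ℝ)`, the derivatives `K'` and `K''`
are bounded on `ℝ`, and `K > 0` on `[0, Φ_F]`. -/
structure IsPhaseResponse (K : ℝ → ℝ) (ΦF : ℝ) : Prop where
  contDiff : ContDiff ℝ 2 K
  bounded_deriv : ∃ C : ℝ, ∀ x, |deriv K x| ≤ C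
  bounded_deriv_two : ∃ C : ℝ, ∀ x, |iteratedDeriv 2 K x| ≤ C
  pos : ∀ φ ∈ Icc 0 ΦF, 0 < K φ

/-- `k_min = K'(0) + ∫₀^{Φ_F} (K''(φ))₋ dφ`, where `(x)₋ = min (x, 0)`. -/
def kMin (K : ℝ → ℝ) (ΦF : ℝ) : ℝ :=
  deriv K 0 + ∫ φ in (0 : ℝ)..ΦF, min (iteratedDeriv 2 K φ) 0

/-- The partial derivative `∂_τ Q (τ, η)` of a function on `[0, T) × [0, 1]`
(one-sided at `τ = 0`). -/
def dTime (T : EReal) (Q : ℝ → ℝ → ℝ) (τ η : ℝ) : ℝ :=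
  derivWithin (fun s => Q s η) (timeInterval T) τ

/-- The partial derivative `∂_η Q (τ, η)` of a function on `[0, T) × [0, 1]`
(one-sided at `η = 0` and `η = 1`). -/
def dSpace (Q : ℝ → ℝ → ℝ) (τ η : ℝ) : ℝ :=
  derivWithin (fun x => Q τ x) (Icc 0 1) η

/-- Admissible initial data: increasing (in the wide sense) `C¹` functions on `[0, 1]` with
`q(0) = 0`, `q(1) = Φ_F` and `q'(1) > K(Φ_F)`. -/
structure IsInitialDatum (K : ℝ → ℝ) (ΦF : ℝ) (q : ℝ → ℝ) : Prop where
  contDiffOn : ContDiffOn ℝ 1 q (Icc 0 1)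
  monotoneOn : MonotoneOn q (Icc 0 1)
  at_zero : q 0 = 0
  at_one : q 1 = ΦF
  deriv_at_one : K ΦF < derivWithin q (Icc 0 1) 1

/-- `(Q, N)` is a classical solution on `[0, T)`, `0 < T ≤ +∞`, with initial datum `q`, of
`∂_τ Q + ∂_η Q = 1 / N(τ) + K(Q)`, `Q(τ, 0) = 0`, `1 / N(τ) = ∂_η Q(τ, 1) - K(Φ_F)`, under the
constraint `K(Φ_F) < ∂_η Q(τ, 1)`. -/
structure IsClassicalSolution (K : ℝ → ℝ) (ΦF : ℝ) (q : ℝ → ℝ) (T : EReal)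
    (Q : ℝ → ℝ → ℝ) (N : ℝ → ℝ) : Prop where
  time_pos : 0 < T
  initialDatum : IsInitialDatum K ΦF q
  contDiffOn : ContDiffOn ℝ 1 (fun p : ℝ × ℝ => Q p.1 p.2) (timeInterval T ×ˢ Icc 0 1)
  monotoneOn : ∀ τ ∈ timeInterval T, MonotoneOn (Q τ) (Icc 0 1)
  rate_continuousOn : ContinuousOn N (timeInterval T)
  rate_pos : ∀ τ ∈ timeInterval T, 0 < N τ
  equation : ∀ τ ∈ timeInterval T, ∀ η ∈ Ioo (0 : ℝ) 1,
    dTime T Q τ η + dSpace Q τ η = 1 / N τ + K (Q τ η)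
  boundary : ∀ τ ∈ timeInterval T, Q τ 0 = 0
  rate : ∀ τ ∈ timeInterval T, 1 / N τ = dSpace Q τ 1 - K ΦF
  initial : ∀ η ∈ Icc (0 : ℝ) 1, Q 0 η = q η
  constraint : ∀ τ ∈ timeInterval T, K ΦF < dSpace Q τ 1

/-- `(Q, N)` and `(Q', N')` coincide on the time interval `[0, T)`. -/
def AgreeUpTo (T : EReal) (Q : ℝ → ℝ → ℝ) (N : ℝ → ℝ) (Q' : ℝ → ℝ → ℝ) (N' : ℝ → ℝ) : Prop :=
  ∀ τ ∈ timeInterval T, (∀ η ∈ Icc (0 : ℝ) 1, Q τ η = Q' τ η) ∧ N τ = N' τ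

/-- `T` is the maximal existence time of classical solutions with initial datum `q`, and `(Q, N)` is
a classical solution on the whole of `[0, T)`. -/
def IsMaximalSolution (K : ℝ → ℝ) (ΦF : ℝ) (q : ℝ → ℝ) (T : EReal)
    (Q : ℝ → ℝ → ℝ) (N : ℝ → ℝ) : Prop :=
  IsClassicalSolution K ΦF q T Q N ∧
    ∀ (T' : EReal) (Q' : ℝ → ℝ → ℝ) (N' : ℝ → ℝ), IsClassicalSolution K ΦF q T' Q' N' → T' ≤ T

/-- The solution `(Q, N)` on `[0, T)` with initial datum `q` blows up in finite time: it is the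
restriction of a maximal solution whose existence time `τstar` is finite, and the firing rate of
the latter tends to `+∞` as `τ → τstar⁻`. -/
def BlowsUpInFiniteTime (K : ℝ → ℝ) (ΦF : ℝ) (q : ℝ → ℝ) (T : EReal)
    (Q : ℝ → ℝ → ℝ) (N : ℝ → ℝ) : Prop :=
  ∃ (τstar : ℝ) (Qm : ℝ → ℝ → ℝ) (Nm : ℝ → ℝ), T ≤ (τstar : EReal) ∧
    IsMaximalSolution K ΦF q τstar Qm Nm ∧ AgreeUpTo T Q N Qm Nm ∧
    Tendsto Nm (𝓝[<] τstar) atTop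

/-- A steady state `(qs, ns)`: a classical solution on `[0, +∞)` that does not depend on time. -/
def IsSteadyState (K : ℝ → ℝ) (ΦF : ℝ) (qs : ℝ → ℝ) (ns : ℝ) : Prop :=
  IsClassicalSolution K ΦF qs ⊤ (fun _ => qs) (fun _ => ns)

end PulseCoupled

end

/-! Everything is expressed through the density `w = ∂_η Q`. It is carried at unit speed with source
`K'(Q) w`, it enters with `w(τ,0) = w(τ,1) - K(Φ_F) + K(0)`, and its total mass stays equal to
`Φ_F`. This formulation keeps its meaning when the rate `w(·,1) - K(Φ_F) = 1/N` vanishes or becomes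
negative. Mild solutions therefore exist on every bounded interval, and a classical solution is a
mild one as long as the rate is positive.

For two mild solutions, the difference `z` of the densities takes equal values at `η = 0` and `η =
1`. The flux terms therefore cancel in the growth of the `L¹` distance, and only `∫ sgn z (K'(Q₁) w₁
- K'(Q₂) w₂)` remains. For nonnegative densities this is at least `kMin` times the `L¹` distance
(`kMin_mul_le`): interpolate linearly between the two densities, then integrate by parts and use
that `z` has mean zero. When `kMin > 0`, distinct nonnegative solutions thus separate exponentially
(`IsMild.distL1_growth`). In particular two steady states, whose distance is constant, coincide.

Let a solution not be constant in time, and compare its mild continuation with a time shift of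
itself. If the rate stayed positive forever, both densities would remain nonnegative with mass
`Φ_F`, so their distance would never exceed `2 Φ_F`, against exponential growth. The rate therefore
reaches zero (`IsClassicalSolution.exists_rate_nonpos`). At its first zero `N = 1/rate` tends to
`+∞`, and by uniqueness of mild solutions no classical solution extends beyond that time. A solution
that is constant in time is a steady state, exists globally and does not blow up. -/

noncomputable section

namespace PulseCoupled

open MeasureTheory intervalIntegral

/-! ### The `L¹` expansion inequality for `K` -/

/-- A sign function written as a quotient; it vanishes at `0`. -/
def sgn (x : ℝ) : ℝ := x / |x|

theorem abs_sgn_le (x : ℝ) : |sgn x| ≤ 1 := by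
  unfold sgn
  rw [abs_div, abs_abs]
  exact div_self_le_one _

theorem sgn_mul_self (x : ℝ) : sgn x * x = |x| := by
  unfold sgn
  rcases eq_or_ne x 0 with rfl | h
  · simp
  · have : |x| ≠ 0 := abs_ne_zero.2 h
    field_simp
    rw [sq_abs]

theorem measurable_sgn : Measurable sgn := by
  unfold sgn
  exact measurable_id.div measurable_id.abs

/-- A bounded measurable function of a continuous function times a continuous function is
interval integrable. -/
theorem intervalIntegrable_mul_of_abs_le_one {s f : ℝ → ℝ} (hs : Measurable s)
    (hs1 : ∀ x, |s x| ≤ 1) (hf : Continuous f) (a b : ℝ) :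
    IntervalIntegrable (fun x => s x * f x) volume a b := by
  refine (hf.intervalIntegrable a b).mono_fun (hs.mul hf.measurable).aestronglyMeasurable ?_
  filter_upwards with x
  rw [norm_mul]
  exact mul_le_of_le_one_left (norm_nonneg _) (hs1 x)

theorem hasDerivAt_primitive {f : ℝ → ℝ} (hf : Continuous f) (a x : ℝ) :
    HasDerivAt (fun x => ∫ y in a..x, f y) (f x) x :=
  (hf.integral_hasStrictDerivAt a x).hasDerivAt

/-- Let `V` and `D` be the primitives of `|z|` and `z` from `0`, and `Z` the total integral of
`|z|`. Integration by parts leaves `p 0 * Z` plus the integral of `p' (Z - V + sgn z · D)`. Since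
`z` has mean zero, `|D|` is bounded both by `V` and by `Z - V`, so the factor of `p'` lies in `[0,
Z]`. -/
theorem weighted_variation_le {p p' z : ℝ → ℝ} (hp : ∀ x, HasDerivAt p (p' x) x)
    (hp' : Continuous p') (hz : Continuous z) (hz0 : ∫ x in (0 : ℝ)..1, z x = 0) :
    (p 0 + ∫ x in (0 : ℝ)..1, min (p' x) 0) * ∫ x in (0 : ℝ)..1, |z x| ≤
      ∫ x in (0 : ℝ)..1, sgn (z x) * (p x * z x + p' x * ∫ y in (0 : ℝ)..x, z y) := by
  have hpc : Continuous p := continuous_iff_continuousAt.2 fun x => (hp x).continuousAt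
  have hD : Continuous fun x => ∫ y in (0 : ℝ)..x, z y :=
    continuous_primitive (fun a b => hz.intervalIntegrable a b) 0
  set Z := ∫ x in (0 : ℝ)..1, |z x| with hZ
  -- This primitive of `|z|` is normalised to vanish at `1`, so that only the boundary term at `0`
  -- survives.
  have hv : ∀ x, HasDerivAt (fun x => (∫ y in (0 : ℝ)..x, |z y|) - Z) |z x| x := fun x =>
    (hasDerivAt_primitive hz.abs 0 x).sub_const Z
  have hV : Continuous fun x => (∫ y in (0 : ℝ)..x, |z y|) - Z :=
    continuous_iff_continuousAt.2 fun x => (hv x).continuousAt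
  have hparts := integral_mul_deriv_eq_deriv_mul (a := 0) (b := 1) (fun x _ => hp x)
    (fun x _ => hv x) (hp'.intervalIntegrable _ _) (hz.abs.intervalIntegrable _ _)
  have hiσ : IntervalIntegrable (fun x => sgn (z x) * (p' x * ∫ y in (0 : ℝ)..x, z y))
      volume 0 1 :=
    intervalIntegrable_mul_of_abs_le_one (measurable_sgn.comp hz.measurable)
      (fun x => abs_sgn_le _) (hp'.mul hD) _ _
  have hip : IntervalIntegrable (fun x => p x * |z x|) volume 0 1 :=
    (hpc.mul hz.abs).intervalIntegrable _ _
  have hiV : IntervalIntegrable (fun x => -(p' x * ((∫ y in (0 : ℝ)..x, |z y|) - Z)))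
      volume 0 1 := (hp'.mul hV).neg.intervalIntegrable _ _
  have hsplit : (∫ x in (0 : ℝ)..1, sgn (z x) * (p x * z x + p' x * ∫ y in (0 : ℝ)..x, z y)) =
      (∫ x in (0 : ℝ)..1, p x * |z x|) +
        ∫ x in (0 : ℝ)..1, sgn (z x) * (p' x * ∫ y in (0 : ℝ)..x, z y) := by
    rw [← integral_add hip hiσ]
    congr 1
    ext x
    rw [← sgn_mul_self]
    ring
  suffices hmain : (∫ x in (0 : ℝ)..1, min (p' x) 0) * Z ≤
      ∫ x in (0 : ℝ)..1, (-(p' x * ((∫ y in (0 : ℝ)..x, |z y|) - Z)) +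
        sgn (z x) * (p' x * ∫ y in (0 : ℝ)..x, z y)) by
    rw [integral_add hiV hiσ, intervalIntegral.integral_neg] at hmain
    rw [hsplit, hparts, integral_same, sub_self, mul_zero]
    linarith
  rw [← intervalIntegral.integral_mul_const]
  refine integral_mono_on zero_le_one
    (((hp'.min continuous_const).mul continuous_const).intervalIntegrable _ _)
    (hiV.add hiσ) fun x hx => ?_
  have hadd : (∫ y in (0 : ℝ)..x, |z y|) + ∫ y in x..1, |z y| = Z :=
    integral_add_adjacent_intervals (hz.abs.intervalIntegrable _ _) (hz.abs.intervalIntegrable _ _)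
  have hadd' : (∫ y in (0 : ℝ)..x, z y) + ∫ y in x..1, z y = 0 := by
    rw [integral_add_adjacent_intervals (hz.intervalIntegrable _ _) (hz.intervalIntegrable _ _),
      hz0]
  have h1 : |∫ y in (0 : ℝ)..x, z y| ≤ ∫ y in (0 : ℝ)..x, |z y| :=
    abs_integral_le_integral_abs hx.1
  have h2 : |∫ y in x..1, z y| ≤ ∫ y in x..1, |z y| := abs_integral_le_integral_abs hx.2
  have h3 : ∫ y in x..1, z y = -∫ y in (0 : ℝ)..x, z y := by linarith
  rw [h3, abs_neg] at h2
  set D := ∫ y in (0 : ℝ)..x, z y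
  set V := ∫ y in (0 : ℝ)..x, |z y|
  have h4 : |sgn (z x) * D| ≤ |D| := by
    rw [abs_mul]; exact mul_le_of_le_one_left (abs_nonneg _) (abs_sgn_le _)
  have h5 := abs_le.1 h4
  have key : -(p' x * (V - Z)) + sgn (z x) * (p' x * D) = p' x * (Z - V + sgn (z x) * D) := by ring
  rw [key]
  rcases le_total (p' x) 0 with h | h
  · rw [min_eq_left h]
    exact mul_le_mul_of_nonpos_left (by linarith) h
  · rw [min_eq_right h, zero_mul]
    exact mul_nonneg h (by linarith)

/-- The weight `s` is only bounded and measurable, which admits signs of continuous functions. The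
dominating constant is the bound of `G'` on a compact neighbourhood in `θ` times the interval of
integration. -/
theorem hasDerivAt_integral_mul {s : ℝ → ℝ} (hs : Measurable s) (hs1 : ∀ x, |s x| ≤ 1)
    {G G' : ℝ → ℝ → ℝ} (hG : ∀ θ, Continuous (G θ)) (hG' : Continuous (Function.uncurry G'))
    (h : ∀ θ x, HasDerivAt (fun θ => G θ x) (G' θ x) θ) (a b θ : ℝ) :
    HasDerivAt (fun θ => ∫ x in a..b, s x * G θ x)
      (∫ x in a..b, s x * G' θ x) θ := by
  obtain ⟨C, hC⟩ := ((isCompact_closedBall θ 1).prod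
    (isCompact_uIcc (a := a) (b := b))).exists_bound_of_continuousOn hG'.continuousOn
  refine (intervalIntegral.hasDerivAt_integral_of_dominated_loc_of_deriv_le (μ := volume)
    (a := a) (b := b) (F := fun θ x => s x * G θ x) (F' := fun θ x => s x * G' θ x)
    (bound := fun _ => C)
    (Metric.ball_mem_nhds θ one_pos) ?_ ?_ ?_ ?_ ?_ ?_).2
  · exact Eventually.of_forall fun θ' => (hs.mul (hG θ').measurable).aestronglyMeasurable
  · exact intervalIntegrable_mul_of_abs_le_one hs hs1 (hG θ) _ _
  · exact (hs.mul (hG'.uncurry_left θ).measurable).aestronglyMeasurable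
  · refine Eventually.of_forall fun x hx θ' hθ' => ?_
    rw [norm_mul]
    exact (mul_le_of_le_one_left (norm_nonneg _) (hs1 x)).trans
      (hC (θ', x) ⟨Metric.ball_subset_closedBall hθ', uIoc_subset_uIcc hx⟩)
  · exact intervalIntegrable_const
  · exact Eventually.of_forall fun x _ θ' _ => (h θ' x).const_mul _

theorem hasDerivAt_deriv_of_contDiff_two {K : ℝ → ℝ} (hK : ContDiff ℝ 2 K) (x : ℝ) :
    HasDerivAt (deriv K) (iteratedDeriv 2 K x) x := by
  have h : iteratedDeriv 2 K = deriv (deriv K) := by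
    rw [iteratedDeriv_succ, iteratedDeriv_one]
  rw [h]
  have h1 : ContDiff ℝ 1 (deriv K) := ((contDiff_succ_iff_deriv (n := 1)).1 hK).2.2
  exact ((h1.differentiable one_ne_zero) x).hasDerivAt

theorem hasDerivAt_of_contDiff_two {K : ℝ → ℝ} (hK : ContDiff ℝ 2 K) (x : ℝ) :
    HasDerivAt K (deriv K x) x :=
  ((hK.differentiable two_ne_zero) x).hasDerivAt

theorem continuous_deriv_of_contDiff_two {K : ℝ → ℝ} (hK : ContDiff ℝ 2 K) :
    Continuous (deriv K) :=
  hK.continuous_deriv one_le_two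

theorem continuous_iteratedDeriv_two {K : ℝ → ℝ} (hK : ContDiff ℝ 2 K) :
    Continuous (iteratedDeriv 2 K) :=
  hK.continuous_iteratedDeriv 2 le_rfl

/-- The linearised form of `kMin_mul_le`, at a profile with density `w` and perturbation `z`. -/
theorem kMin_mul_le_linearised {K : ℝ → ℝ} {ΦF : ℝ} (hK : ContDiff ℝ 2 K) {w z : ℝ → ℝ}
    (hw : Continuous w) (hz : Continuous z) (hw0 : ∀ x ∈ Icc (0 : ℝ) 1, 0 ≤ w x)
    (hwm : ∫ x in (0 : ℝ)..1, w x = ΦF) (hz0 : ∫ x in (0 : ℝ)..1, z x = 0) :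
    kMin K ΦF * ∫ x in (0 : ℝ)..1, |z x| ≤
      ∫ x in (0 : ℝ)..1, sgn (z x) * (deriv K (∫ y in (0 : ℝ)..x, w y) * z x +
        iteratedDeriv 2 K (∫ y in (0 : ℝ)..x, w y) * w x * ∫ y in (0 : ℝ)..x, z y) := by
  have hQ : ∀ x, HasDerivAt (fun x => ∫ y in (0 : ℝ)..x, w y) (w x) x := fun x =>
    hasDerivAt_primitive hw 0 x
  have hQc : Continuous fun x => ∫ y in (0 : ℝ)..x, w y :=
    continuous_iff_continuousAt.2 fun x => (hQ x).continuousAt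
  have h := weighted_variation_le (p := fun x => deriv K (∫ y in (0 : ℝ)..x, w y))
    (p' := fun x => iteratedDeriv 2 K (∫ y in (0 : ℝ)..x, w y) * w x)
    (fun x => (hasDerivAt_deriv_of_contDiff_two hK _).comp x (hQ x))
    (((continuous_iteratedDeriv_two hK).comp hQc).mul hw) hz hz0
  have hk : kMin K ΦF = deriv K (∫ y in (0 : ℝ)..0, w y) +
      ∫ x in (0 : ℝ)..1, min (iteratedDeriv 2 K (∫ y in (0 : ℝ)..x, w y) * w x) 0 := by
    -- Substitution `φ = Q(x)`, with `Q` the primitive of `w`: since `w ≥ 0`, the factor `w` moves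
    -- inside the minimum, and the integral in `kMin` becomes one over `[0, 1]`.
    have hsub := integral_comp_mul_deriv (a := 0) (b := 1)
      (g := fun φ => min (iteratedDeriv 2 K φ) 0) (fun x _ => hQ x) hw.continuousOn
      ((continuous_iteratedDeriv_two hK).min continuous_const)
    rw [integral_same, hwm] at hsub
    rw [kMin, integral_same, ← hsub]
    congr 1
    refine integral_congr fun x hx => ?_
    rw [uIcc_of_le zero_le_one] at hx
    simp only [Function.comp]
    rw [min_mul_of_nonneg _ _ (hw0 x hx), zero_mul]
  rw [hk]
  exact h

/-- The `L¹` dissipativity inequality behind the dichotomy: for two increasing profiles with the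
same end values, `K` expands the `L¹` distance of the densities at rate at least `kMin`. -/
theorem kMin_mul_le {K : ℝ → ℝ} {ΦF : ℝ} (hK : ContDiff ℝ 2 K) {w₁ w₂ : ℝ → ℝ}
    (h₁ : Continuous w₁) (h₂ : Continuous w₂) (h₁0 : ∀ x ∈ Icc (0 : ℝ) 1, 0 ≤ w₁ x)
    (h₂0 : ∀ x ∈ Icc (0 : ℝ) 1, 0 ≤ w₂ x)
    (hm₁ : ∫ x in (0 : ℝ)..1, w₁ x = ΦF) (hm₂ : ∫ x in (0 : ℝ)..1, w₂ x = ΦF) :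
    kMin K ΦF * ∫ x in (0 : ℝ)..1, |w₁ x - w₂ x| ≤
      ∫ x in (0 : ℝ)..1, sgn (w₁ x - w₂ x) * (deriv K (∫ y in (0 : ℝ)..x, w₁ y) * w₁ x -
        deriv K (∫ y in (0 : ℝ)..x, w₂ y) * w₂ x) := by
  have hK1 := continuous_deriv_of_contDiff_two hK
  have hK2 := continuous_iteratedDeriv_two hK
  have hi₁ : ∀ a b, IntervalIntegrable w₁ volume a b := fun a b => h₁.intervalIntegrable a b
  have hi₂ : ∀ a b, IntervalIntegrable w₂ volume a b := fun a b => h₂.intervalIntegrable a b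
  have hz : Continuous fun x => w₁ x - w₂ x := h₁.sub h₂
  have hQ₁ : Continuous fun x => ∫ y in (0 : ℝ)..x, w₁ y := continuous_primitive hi₁ 0
  have hQ₂ : Continuous fun x => ∫ y in (0 : ℝ)..x, w₂ y := continuous_primitive hi₂ 0
  set D : ℝ → ℝ := fun x => (∫ y in (0 : ℝ)..x, w₁ y) - ∫ y in (0 : ℝ)..x, w₂ y with hD
  have hDc : Continuous D := hQ₁.sub hQ₂
  set Q₂ : ℝ → ℝ := fun x => ∫ y in (0 : ℝ)..x, w₂ y with hQ₂def
  have hDi : ∀ x, ∫ y in (0 : ℝ)..x, (w₁ y - w₂ y) = D x := fun x =>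
    integral_sub (hi₁ _ _) (hi₂ _ _)
  have hQθ : ∀ θ x : ℝ, ∫ y in (0 : ℝ)..x, (w₂ y + θ * (w₁ y - w₂ y)) = Q₂ x + θ * D x := by
    intro θ x
    rw [integral_add (hi₂ _ _) ((hz.const_mul θ).intervalIntegrable _ _),
      intervalIntegral.integral_const_mul, hDi]
  -- Interpolation from `w₂` to `w₁` with the sign frozen: the right-hand side of the claim is `ψ 1
  -- - ψ 0`, and each `ψ' θ` is bounded below by the linearised inequality. Convex combinations keep
  -- the density nonnegative and its mass equal to `ΦF`.
  set ψ : ℝ → ℝ := fun θ => ∫ x in (0 : ℝ)..1, sgn (w₁ x - w₂ x) *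
    (deriv K (Q₂ x + θ * D x) * (w₂ x + θ * (w₁ x - w₂ x))) with hψ
  set F' : ℝ → ℝ → ℝ := fun θ x => iteratedDeriv 2 K (Q₂ x + θ * D x) * D x *
    (w₂ x + θ * (w₁ x - w₂ x)) + deriv K (Q₂ x + θ * D x) * (w₁ x - w₂ x) with hF'
  have hF'c : Continuous (Function.uncurry F') := by
    simp only [hF', Function.uncurry_def]
    fun_prop
  have hsm : Measurable fun x => sgn (w₁ x - w₂ x) := measurable_sgn.comp hz.measurable
  have hGc : ∀ θ : ℝ, Continuous fun x =>
      deriv K (Q₂ x + θ * D x) * (w₂ x + θ * (w₁ x - w₂ x)) := fun θ => by fun_prop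
  have hder : ∀ θ : ℝ, HasDerivAt ψ (∫ x in (0 : ℝ)..1, sgn (w₁ x - w₂ x) * F' θ x) θ := by
    intro θ
    refine hasDerivAt_integral_mul hsm (fun _ => abs_sgn_le _) hGc hF'c (fun θ x => ?_) 0 1 θ
    have e1 : HasDerivAt (fun θ => Q₂ x + θ * D x) (D x) θ := by
      simpa using ((hasDerivAt_id θ).mul_const (D x)).const_add (Q₂ x)
    have e2 : HasDerivAt (fun θ => w₂ x + θ * (w₁ x - w₂ x)) (w₁ x - w₂ x) θ := by
      simpa using ((hasDerivAt_id θ).mul_const (w₁ x - w₂ x)).const_add (w₂ x)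
    exact ((hasDerivAt_deriv_of_contDiff_two hK _).comp θ e1).mul e2
  have hlow : ∀ θ ∈ Icc (0 : ℝ) 1, kMin K ΦF * ∫ x in (0 : ℝ)..1, |w₁ x - w₂ x| ≤
      ∫ x in (0 : ℝ)..1, sgn (w₁ x - w₂ x) * F' θ x := by
    intro θ hθ
    have h := kMin_mul_le_linearised (ΦF := ΦF) hK (w := fun x => w₂ x + θ * (w₁ x - w₂ x))
      (z := fun x => w₁ x - w₂ x) (by fun_prop) hz ?_ ?_ ?_
    · refine h.trans_eq ?_
      simp only [hQθ, hDi, hF']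
      congr 1
      ext x
      ring
    · intro x hx
      have := mul_nonneg hθ.1 (h₁0 x hx)
      have := mul_nonneg (sub_nonneg.2 hθ.2) (h₂0 x hx)
      nlinarith
    · rw [hQθ]; simp only [hQ₂def, hD, hm₁, hm₂]; ring
    · rw [hDi]; simp only [hD, hm₁, hm₂]; ring
  have hmv := (convex_Icc (0 : ℝ) 1).mul_sub_le_image_sub_of_le_deriv (f := ψ)
    (C := kMin K ΦF * ∫ x in (0 : ℝ)..1, |w₁ x - w₂ x|)
    (fun θ _ => (hder θ).continuousAt.continuousWithinAt)
    (fun θ _ => (hder θ).differentiableAt.differentiableWithinAt)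
    (fun θ hθ => by rw [(hder θ).deriv]; exact hlow θ (interior_subset hθ))
    0 (left_mem_Icc.2 zero_le_one) 1 (right_mem_Icc.2 zero_le_one) zero_le_one
  rw [sub_zero, mul_one] at hmv
  refine hmv.trans_eq ?_
  simp only [hψ]
  rw [← integral_sub
    (intervalIntegrable_mul_of_abs_le_one hsm (fun _ => abs_sgn_le _) (hGc _) _ _)
    (intervalIntegrable_mul_of_abs_le_one hsm (fun _ => abs_sgn_le _) (hGc _) _ _)]
  congr 1
  ext x
  simp only [hD, hQ₂def]
  ring_nf

/-! ### One-sided differentiation of integrals under unit-speed transport -/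

/-- Lower bound for the right slope of `τ ↦ ∫₀^η φ (z τ x) dx` when `z` is transported with unit
speed with source `f`, and `φ b - φ a ≥ m a (b - a)` with `m` positively homogeneous and Lipschitz in
its second argument. -/
theorem eventually_lt_integral_sub_of_transport {z f : ℝ → ℝ → ℝ}
    (hz : Continuous (Function.uncurry z)) (hf : Continuous (Function.uncurry f))
    {τ S η : ℝ} (hτS : τ < S) (hη0 : 0 < η) (hη1 : η ≤ 1)
    (hchar : ∀ h x, 0 ≤ h → 0 ≤ x → τ + h ≤ S → x + h < 1 →
      z (τ + h) (x + h) - z τ x = ∫ r in (0 : ℝ)..h, f (τ + r) (x + r))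
    {φ : ℝ → ℝ} (hφ : Continuous φ) {m : ℝ → ℝ → ℝ} (hm : Measurable (Function.uncurry m))
    (hsub : ∀ a b, φ a + m a (b - a) ≤ φ b) (hhom : ∀ a d h, 0 ≤ h → m a (h * d) = h * m a d)
    (hlip : ∀ a d d', |m a d - m a d'| ≤ |d - d'|) {r : ℝ}
    (hr : r < φ (z τ 0) - φ (z τ η) + ∫ x in (0 : ℝ)..η, m (z τ x) (f τ x)) :
    ∀ᶠ s in 𝓝[>] τ,
      r * (s - τ) < (∫ x in (0 : ℝ)..η, φ (z s x)) - ∫ x in (0 : ℝ)..η, φ (z τ x) := by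
  set G := φ (z τ 0) - φ (z τ η) + ∫ x in (0 : ℝ)..η, m (z τ x) (f τ x) with hG
  -- Four errors of size at most `h * ε` occur: inflow, outflow, source along characteristics, and
  -- the omitted end piece. The fifth `ε` makes the inequality strict.
  set ε := (G - r) / 5 with hε
  have hε0 : 0 < ε := by rw [hε]; linarith
  have hcpt : IsCompact (Icc τ (τ + 1) ×ˢ Icc (0 : ℝ) 1) := isCompact_Icc.prod isCompact_Icc
  have hφz : Continuous fun p : ℝ × ℝ => φ (z p.1 p.2) := hφ.comp hz
  obtain ⟨δ₁, hδ₁, hu₁⟩ := Metric.uniformContinuousOn_iff.1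
    (hcpt.uniformContinuousOn_of_continuous hφz.continuousOn) ε hε0
  obtain ⟨δ₂, hδ₂, hu₂⟩ := Metric.uniformContinuousOn_iff.1
    (hcpt.uniformContinuousOn_of_continuous hf.continuousOn) ε hε0
  have hzs : ∀ s, Continuous (z s) := fun s => hz.uncurry_left s
  have hφs : ∀ s, Continuous fun x => φ (z s x) := fun s => hφ.comp (hzs s)
  have hfτ : Continuous (f τ) := hf.uncurry_left τ
  have hmabs : ∀ a d, |m a d| ≤ |d| := fun a d => by
    have h0 : m a 0 = 0 := by simpa using hhom a 0 0 le_rfl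
    simpa [h0] using hlip a d 0
  obtain ⟨B, hB⟩ := (isCompact_Icc (a := (0 : ℝ)) (b := 1)).exists_bound_of_continuousOn
    hfτ.continuousOn
  have hB0 : 0 ≤ B := (norm_nonneg _).trans (hB 0 (left_mem_Icc.2 zero_le_one))
  have hmm : Measurable fun x => m (z τ x) (f τ x) :=
    hm.comp ((hzs τ).measurable.prodMk hfτ.measurable)
  have hmi : ∀ a b, IntervalIntegrable (fun x => m (z τ x) (f τ x)) volume a b := fun a b =>
    (hfτ.intervalIntegrable a b).mono_fun hmm.aestronglyMeasurable
      (Eventually.of_forall fun x => hmabs _ _)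
  have hφi : ∀ s a b, IntervalIntegrable (fun x => φ (z s x)) volume a b := fun s a b =>
    (hφs s).intervalIntegrable a b
  set δ := min (min δ₁ δ₂) (min (min η (S - τ)) (ε / (B + 1))) with hδ
  have hδ0 : 0 < δ := by
    refine lt_min (lt_min hδ₁ hδ₂) (lt_min (lt_min hη0 (by linarith)) (by positivity))
  filter_upwards [Ioo_mem_nhdsGT (show τ < τ + δ by linarith)] with s hs
  obtain ⟨h, rfl⟩ : ∃ h, s = τ + h := ⟨s - τ, by ring⟩
  have h0 : 0 < h := by linarith [hs.1]
  have hhδ : h < δ := by linarith [hs.2]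
  have hh1 : h < δ₁ := hhδ.trans_le ((min_le_left _ _).trans (min_le_left _ _))
  have hh2 : h < δ₂ := hhδ.trans_le ((min_le_left _ _).trans (min_le_right _ _))
  have hhη : h < η :=
    hhδ.trans_le ((min_le_right _ _).trans ((min_le_left _ _).trans (min_le_left _ _)))
  have hhS : h < S - τ :=
    hhδ.trans_le ((min_le_right _ _).trans ((min_le_left _ _).trans (min_le_right _ _)))
  have hhB : h * B ≤ ε := by
    have : h < ε / (B + 1) := hhδ.trans_le ((min_le_right _ _).trans (min_le_right _ _))
    rw [lt_div_iff₀ (by linarith)] at this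
    linarith
  have hleft : h * (φ (z τ 0) - ε) ≤ ∫ x in (0 : ℝ)..h, φ (z (τ + h) x) := by
    have := integral_mono_on (f := fun _ => φ (z τ 0) - ε) h0.le intervalIntegrable_const
      (hφi (τ + h) 0 h) fun x hx => by
        have := hu₁ (τ + h, x) ⟨⟨by simp [h0.le], by simp; linarith⟩, hx.1, by linarith [hx.2]⟩
          (τ, 0) ⟨⟨le_rfl, by simp⟩, le_rfl, zero_le_one⟩ (by
            rw [Prod.dist_eq, max_lt_iff]
            simp only [Real.dist_eq]
            rw [abs_lt, abs_lt]
            refine ⟨⟨?_, ?_⟩, ?_, ?_⟩ <;> linarith [hx.1, hx.2])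
        rw [Real.dist_eq, abs_lt] at this
        linarith [this.1]
    rwa [intervalIntegral.integral_const, smul_eq_mul, sub_zero] at this
  have hright : ∫ x in (η - h)..η, φ (z τ x) ≤ h * (φ (z τ η) + ε) := by
    have := integral_mono_on (g := fun _ => φ (z τ η) + ε) (show η - h ≤ η by linarith)
      (hφi τ _ _) intervalIntegrable_const fun x hx => by
        have := hu₁ (τ, x) ⟨⟨le_rfl, by simp⟩, by linarith [hx.1], by linarith [hx.2]⟩
          (τ, η) ⟨⟨le_rfl, by simp⟩, hη0.le, hη1⟩ (by
            rw [Prod.dist_eq, max_lt_iff]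
            simp only [Real.dist_eq]
            rw [abs_lt, abs_lt]
            refine ⟨⟨?_, ?_⟩, ?_, ?_⟩ <;> linarith [hx.1, hx.2])
        rw [Real.dist_eq, abs_lt] at this
        linarith [this.2]
    rwa [intervalIntegral.integral_const, smul_eq_mul, sub_sub_cancel] at this
  -- On the bulk, values at `x` and `x + h` are compared along a characteristic, where the increment
  -- of `z` is `h * f τ x` up to `ε * h`. No derivative of `z` is needed.
  have hmid : h * (∫ x in (0 : ℝ)..(η - h), m (z τ x) (f τ x)) - h * ε ≤
      (∫ x in (0 : ℝ)..(η - h), φ (z (τ + h) (x + h))) - ∫ x in (0 : ℝ)..(η - h), φ (z τ x) := by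
    have hsh : IntervalIntegrable (fun x => φ (z (τ + h) (x + h))) volume 0 (η - h) :=
      ((hφs (τ + h)).comp (continuous_id.add continuous_const)).intervalIntegrable _ _
    have h1 : (∫ x in (0 : ℝ)..(η - h), (h * m (z τ x) (f τ x) - h * ε)) ≤
        ∫ x in (0 : ℝ)..(η - h), (φ (z (τ + h) (x + h)) - φ (z τ x)) := by
      refine integral_mono_on_of_le_Ioo (by linarith)
        (((hmi _ _).const_mul h).sub intervalIntegrable_const) (hsh.sub (hφi _ _ _)) fun x hx => ?_
      have hd := hchar h x h0.le hx.1.le (by linarith) (by linarith [hx.2])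
      have hs := hsub (z τ x) (z (τ + h) (x + h))
      rw [hd] at hs
      have hclose : |(∫ r in (0 : ℝ)..h, f (τ + r) (x + r)) - h * f τ x| ≤ ε * h := by
        have hc : Continuous fun r => f (τ + r) (x + r) :=
          hf.comp ((continuous_const.add continuous_id).prodMk (continuous_const.add continuous_id))
        have e : (∫ r in (0 : ℝ)..h, f (τ + r) (x + r)) - h * f τ x =
            ∫ r in (0 : ℝ)..h, (f (τ + r) (x + r) - f τ x) := by
          rw [integral_sub (hc.intervalIntegrable _ _) intervalIntegrable_const]
          simp
        rw [e]
        have := norm_integral_le_of_norm_le_const (a := 0) (b := h) (C := ε)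
          (f := fun r => f (τ + r) (x + r) - f τ x) fun r hr => by
            rw [uIoc_of_le h0.le] at hr
            have := hu₂ (τ + r, x + r)
              ⟨⟨by simp [hr.1.le], by simp; linarith [hr.2]⟩, by linarith [hx.1, hr.1],
                by linarith [hx.2, hr.2]⟩
              (τ, x) ⟨⟨le_rfl, by simp⟩, hx.1.le, by linarith [hx.2]⟩ (by
                rw [Prod.dist_eq, max_lt_iff]
                simp only [Real.dist_eq]
                rw [abs_lt, abs_lt]
                refine ⟨⟨?_, ?_⟩, ?_, ?_⟩ <;> linarith [hr.1, hr.2])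
            rw [Real.dist_eq] at this
            exact this.le
        rw [Real.norm_eq_abs, sub_zero, abs_of_pos h0] at this
        exact this
      have hl := (hlip (z τ x) (∫ r in (0 : ℝ)..h, f (τ + r) (x + r)) (h * f τ x)).trans hclose
      rw [hhom _ _ _ h0.le] at hl
      linarith [(abs_le.1 hl).1]
    rw [integral_sub ((hmi _ _).const_mul h) intervalIntegrable_const,
      integral_sub hsh (hφi _ _ _), intervalIntegral.integral_const_mul,
      intervalIntegral.integral_const] at h1
    have h2 : (η - h - 0) • (h * ε) ≤ h * ε := by
      rw [smul_eq_mul]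
      exact mul_le_of_le_one_left (by positivity) (by linarith)
    linarith
  -- The bulk estimate omits `[η - h, η]` from the source integral; the contribution is quadratic in
  -- `h`.
  have htail : ∫ x in (η - h)..η, m (z τ x) (f τ x) ≤ B * h := by
    have := norm_integral_le_of_norm_le_const (a := η - h) (b := η) (C := B)
      (f := fun x => m (z τ x) (f τ x)) fun x hx => by
        rw [uIoc_of_le (by linarith)] at hx
        exact (hmabs _ _).trans (hB x ⟨by linarith [hx.1], by linarith [hx.2]⟩)
    rw [Real.norm_eq_abs, sub_sub_cancel, abs_of_pos h0] at this
    exact (le_abs_self _).trans this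
  have hshift : ∫ x in (0 : ℝ)..(η - h), φ (z (τ + h) (x + h)) =
      ∫ x in h..η, φ (z (τ + h) x) := by
    rw [intervalIntegral.integral_comp_add_right (fun x => φ (z (τ + h) x)) h]
    simp
  have s1 := integral_add_adjacent_intervals (hφi (τ + h) 0 h) (hφi (τ + h) h η)
  have s2 := integral_add_adjacent_intervals (hφi τ 0 (η - h)) (hφi τ (η - h) η)
  have s3 := integral_add_adjacent_intervals (hmi 0 (η - h)) (hmi (η - h) η)
  rw [hshift] at hmid
  have hr5 : r = G - 5 * ε := by rw [hε]; ring
  have hfin : h * (∫ x in (η - h)..η, m (z τ x) (f τ x)) ≤ h * ε :=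
    mul_le_mul_of_nonneg_left (htail.trans (by linarith)) h0.le
  have hGh : h * G = h * φ (z τ 0) - h * φ (z τ η) + h * (∫ x in (0 : ℝ)..(η - h),
      m (z τ x) (f τ x)) + h * ∫ x in (η - h)..η, m (z τ x) (f τ x) := by
    rw [hG, ← s3]; ring
  rw [← s1, ← s2, hr5, add_sub_cancel_left]
  nlinarith [mul_pos h0 hε0]

/-! ### Mild solutions: time derivative of the profile and conservation of mass -/

/-- The profile `∫₀^η w (τ, y) dy` with density `w (τ, ·)`. -/
def cumul (w : ℝ → ℝ → ℝ) (τ η : ℝ) : ℝ := ∫ y in (0 : ℝ)..η, w τ y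

/-- Mild solutions on `[0, S]`, expressed through the density `w = ∂_η Q`, which is transported
along characteristics with source `K'(Q) w`. The rate `1 / N = w (·, 1) - K(ΦF)` may have any
sign. -/
structure IsMild (K : ℝ → ℝ) (ΦF S : ℝ) (w : ℝ → ℝ → ℝ) : Prop where
  continuous : Continuous (Function.uncurry w)
  boundary : ∀ τ ∈ Icc 0 S, w τ 0 = w τ 1 - K ΦF + K 0
  mass_zero : ∫ y in (0 : ℝ)..1, w 0 y = ΦF
  transport : ∀ τ x h, 0 ≤ τ → 0 ≤ h → 0 ≤ x → τ + h ≤ S → x + h < 1 →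
    w (τ + h) (x + h) - w τ x =
      ∫ r in (0 : ℝ)..h, deriv K (cumul w (τ + r) (x + r)) * w (τ + r) (x + r)

theorem continuous_cumul {w : ℝ → ℝ → ℝ} (hw : Continuous (Function.uncurry w)) :
    Continuous (Function.uncurry (cumul w)) := by
  have := intervalIntegral.continuous_parametric_intervalIntegral_of_continuous (μ := volume)
    (a₀ := 0) (f := fun (p : ℝ × ℝ) y => w p.1 y) (s := fun p => p.2)
    (hw.comp ((continuous_fst.comp continuous_fst).prodMk continuous_snd)) continuous_snd
  exact this

theorem hasDerivAt_cumul {w : ℝ → ℝ → ℝ} (hw : Continuous (Function.uncurry w)) (τ η : ℝ) :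
    HasDerivAt (cumul w τ) (w τ η) η :=
  hasDerivAt_primitive (hw.uncurry_left τ) 0 η

theorem IsMild.mono {K : ℝ → ℝ} {ΦF S S' : ℝ} {w : ℝ → ℝ → ℝ} (h : IsMild K ΦF S w)
    (hS : S' ≤ S) : IsMild K ΦF S' w :=
  ⟨h.continuous, fun τ hτ => h.boundary τ ⟨hτ.1, hτ.2.trans hS⟩, h.mass_zero,
    fun τ x r hτ hr hx hS' => h.transport τ x r hτ hr hx (hS'.trans hS)⟩

section Mild

variable {K : ℝ → ℝ} {ΦF S : ℝ} {w : ℝ → ℝ → ℝ}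

theorem continuous_source (hK : ContDiff ℝ 2 K) (hw : Continuous (Function.uncurry w)) :
    Continuous (Function.uncurry fun τ η => deriv K (cumul w τ η) * w τ η) :=
  ((continuous_deriv_of_contDiff_two hK).comp (continuous_cumul hw)).mul hw

theorem integral_source (hK : ContDiff ℝ 2 K) (hw : Continuous (Function.uncurry w)) (τ η : ℝ) :
    ∫ x in (0 : ℝ)..η, deriv K (cumul w τ x) * w τ x = K (cumul w τ η) - K 0 := by
  have h := integral_eq_sub_of_hasDerivAt (a := 0) (b := η)
    (fun x _ => (hasDerivAt_of_contDiff_two hK _).comp x (hasDerivAt_cumul hw τ x))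
    (((continuous_source hK hw).uncurry_left τ).intervalIntegrable _ _)
  rw [h]
  simp [cumul]

/-- The density is merely continuous, so the integral cannot be differentiated under the sign. The
transport estimate with `φ = id` and with `φ = -id` bounds the right slope from both sides. -/
theorem IsMild.hasDerivWithinAt_right (hK : ContDiff ℝ 2 K) (h : IsMild K ΦF S w) {τ η : ℝ}
    (hτ : τ ∈ Ico 0 S) (hη : η ∈ Icc (0 : ℝ) 1) :
    HasDerivWithinAt (fun s => cumul w s η)
      (w τ 0 - w τ η + (K (cumul w τ η) - K 0)) (Ioi τ) τ := by
  rcases hη.1.eq_or_lt with rfl | hη0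
  · simpa [cumul] using (hasDerivWithinAt_const τ (Ioi τ) (0 : ℝ))
  rw [hasDerivWithinAt_iff_tendsto_slope' self_notMem_Ioi]
  have hf := continuous_source hK h.continuous
  have hchar : ∀ r x, 0 ≤ r → 0 ≤ x → τ + r ≤ S → x + r < 1 → w (τ + r) (x + r) - w τ x =
      ∫ s in (0 : ℝ)..r, deriv K (cumul w (τ + s) (x + s)) * w (τ + s) (x + s) :=
    fun r x hr hx hS hx1 => h.transport τ x r hτ.1 hr hx hS hx1
  refine tendsto_order.2 ⟨fun r hr => ?_, fun r hr => ?_⟩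
  · have := eventually_lt_integral_sub_of_transport h.continuous hf hτ.2 hη0 hη.2 hchar
      (φ := fun x => x) continuous_id (m := fun _ d => d) measurable_snd
      (fun a b => by simp) (fun _ _ _ _ => rfl) (fun _ _ _ => le_rfl) (r := r)
      (by rw [integral_source hK h.continuous]; exact hr)
    filter_upwards [this, self_mem_nhdsWithin] with s hs hsτ
    rw [slope_def_field, lt_div_iff₀ (sub_pos.2 hsτ)]
    exact hs
  · have := eventually_lt_integral_sub_of_transport h.continuous hf hτ.2 hη0 hη.2 hchar
      (φ := fun x => -x) continuous_neg (m := fun _ d => -d) measurable_snd.neg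
      (fun a b => by linarith) (fun _ _ _ _ => by ring)
      (fun _ d d' => le_of_eq (by rw [← abs_neg]; congr 1; ring)) (r := -r)
      (by rw [intervalIntegral.integral_neg, integral_source hK h.continuous]; linarith)
    filter_upwards [this, self_mem_nhdsWithin] with s hs hsτ
    rw [slope_def_field, div_lt_iff₀ (sub_pos.2 hsτ)]
    rw [intervalIntegral.integral_neg, intervalIntegral.integral_neg] at hs
    simp only [cumul]
    linarith

/-- The right derivative is continuous in time, so the profile is the integral of a continuous
function and is differentiable from both sides. -/
theorem IsMild.hasDerivWithinAt_time (hK : ContDiff ℝ 2 K) (h : IsMild K ΦF S w) {τ η : ℝ}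
    (hτ : τ ∈ Icc 0 S) (hη : η ∈ Icc (0 : ℝ) 1) :
    HasDerivWithinAt (fun s => cumul w s η)
      (w τ 1 - K ΦF + K (cumul w τ η) - w τ η) (Icc 0 S) τ := by
  set g : ℝ → ℝ := fun τ => w τ 0 - w τ η + (K (cumul w τ η) - K 0) with hg
  have hgc : Continuous g :=
    ((h.continuous.uncurry_right 0).sub (h.continuous.uncurry_right η)).add
      ((hK.continuous.comp ((continuous_cumul h.continuous).uncurry_right η)).sub
        continuous_const)
  have hq : ∀ s ∈ Icc 0 S, cumul w s η = cumul w 0 η + ∫ t in (0 : ℝ)..s, g t := by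
    intro s hs
    have := integral_eq_sub_of_hasDeriv_right_of_le (f := fun s => cumul w s η) (f' := g) hs.1
      ((continuous_cumul h.continuous).uncurry_right η).continuousOn
      (fun x hx => h.hasDerivWithinAt_right hK ⟨hx.1.le, hx.2.trans_le hs.2⟩ hη)
      (hgc.intervalIntegrable _ _)
    rw [this]; ring
  have hval : w τ 1 - K ΦF + K (cumul w τ η) - w τ η = g τ := by
    simp only [hg]; rw [h.boundary τ hτ]; ring
  rw [hval]
  exact ((hasDerivAt_primitive hgc 0 τ).const_add (cumul w 0 η)).hasDerivWithinAt.congr_of_mem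
    hq hτ

theorem abs_sub_le_of_abs_deriv_le {C : ℝ} (hK : ContDiff ℝ 2 K) (hC : ∀ x, |deriv K x| ≤ C) (a b : ℝ) :
    |K a - K b| ≤ C * |a - b| := by
  have := convex_univ.norm_image_sub_le_of_norm_hasDerivWithin_le (f := K) (f' := deriv K) (C := C)
    (fun x _ => (hasDerivAt_of_contDiff_two hK x).hasDerivWithinAt) (fun x _ => hC x)
    (mem_univ b) (mem_univ a)
  simpa using this

theorem abs_deriv_sub_le {C : ℝ} (hK : ContDiff ℝ 2 K) (hC : ∀ x, |iteratedDeriv 2 K x| ≤ C)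
    (a b : ℝ) : |deriv K a - deriv K b| ≤ C * |a - b| := by
  have := convex_univ.norm_image_sub_le_of_norm_hasDerivWithin_le (f := deriv K) (C := C)
    (fun x _ => (hasDerivAt_deriv_of_contDiff_two hK x).hasDerivWithinAt) (fun x _ => hC x)
    (mem_univ b) (mem_univ a)
  simpa using this

/-- The mass `m` solves `m' = K(m) - K(ΦF)`, for which `ΦF` is an equilibrium; Gronwall's inequality
keeps it there. -/
theorem IsMild.mass (hK : IsPhaseResponse K ΦF) (h : IsMild K ΦF S w) {τ : ℝ}
    (hτ : τ ∈ Icc 0 S) : cumul w τ 1 = ΦF := by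
  obtain ⟨C, hC⟩ := hK.bounded_deriv
  have h0 : ‖cumul w 0 1 - ΦF‖ ≤ 0 := by
    have : cumul w 0 1 = ΦF := h.mass_zero
    simp [this]
  have := norm_le_gronwallBound_of_norm_deriv_right_le (f := fun s => cumul w s 1 - ΦF)
    (f' := fun s => K (cumul w s 1) - K ΦF) (δ := 0) (K := C) (ε := 0) (a := 0) (b := S)
    (((continuous_cumul h.continuous).uncurry_right 1).sub continuous_const).continuousOn
    (fun s hs => ?_) h0 (fun s _ => ?_) τ hτ
  · rw [gronwallBound_ε0, zero_mul] at this
    exact sub_eq_zero.1 (norm_le_zero_iff.1 this)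
  · have e := (h.hasDerivWithinAt_right hK.contDiff hs (right_mem_Icc.2 zero_le_one)).sub_const ΦF
    rw [h.boundary s (Ico_subset_Icc_self hs)] at e
    convert e.Ici_of_Ioi using 1
    ring
  · simpa using abs_sub_le_of_abs_deriv_le hK.contDiff hC (cumul w s 1) ΦF

end Mild

/-! ### Comparison of mild solutions: growth, uniqueness, nonnegativity -/

section Compare

variable {K : ℝ → ℝ} {ΦF S : ℝ} {w w₁ w₂ : ℝ → ℝ → ℝ}

theorem IsMild.shift (hK : IsPhaseResponse K ΦF) (h : IsMild K ΦF S w) {a : ℝ}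
    (ha : a ∈ Icc 0 S) : IsMild K ΦF (S - a) (fun τ => w (τ + a)) where
  continuous := h.continuous.comp
    ((continuous_fst.add continuous_const).prodMk continuous_snd)
  boundary τ hτ := h.boundary (τ + a) ⟨by linarith [hτ.1, ha.1], by linarith [hτ.2]⟩
  mass_zero := by rw [zero_add]; exact h.mass hK ha
  transport τ x r hτ hr hx hS hx1 := by
    have := h.transport (τ + a) x r (by linarith [ha.1]) hr hx (by linarith) hx1
    simp only [cumul, add_right_comm τ _ a] at this ⊢
    exact this

/-- The `L¹` distance of two densities at time `τ`. -/
def distL1 (w₁ w₂ : ℝ → ℝ → ℝ) (τ : ℝ) : ℝ := ∫ x in (0 : ℝ)..1, |w₁ τ x - w₂ τ x|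

theorem continuous_distL1 (h₁ : Continuous (Function.uncurry w₁))
    (h₂ : Continuous (Function.uncurry w₂)) : Continuous (distL1 w₁ w₂) :=
  intervalIntegral.continuous_parametric_intervalIntegral_of_continuous' (μ := volume)
    (f := fun τ x => |w₁ τ x - w₂ τ x|) (h₁.sub h₂).abs 0 1

theorem distL1_nonneg (τ : ℝ) : 0 ≤ distL1 w₁ w₂ τ :=
  integral_nonneg zero_le_one fun _ _ => abs_nonneg _

theorem eqOn_of_distL1_eq_zero (h₁ : Continuous (Function.uncurry w₁))
    (h₂ : Continuous (Function.uncurry w₂)) {τ : ℝ} (h : distL1 w₁ w₂ τ = 0) :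
    EqOn (w₁ τ) (w₂ τ) (Icc 0 1) := by
  have hc : Continuous fun x => |w₁ τ x - w₂ τ x| :=
    ((h₁.uncurry_left τ).sub (h₂.uncurry_left τ)).abs
  rw [distL1, integral_eq_zero_iff_of_le_of_nonneg_ae zero_le_one
    (Eventually.of_forall fun _ => abs_nonneg _) (hc.intervalIntegrable _ _),
    Measure.restrict_congr_set Ioc_ae_eq_Icc] at h
  have := Measure.eqOn_Icc_of_ae_eq volume zero_ne_one h hc.continuousOn continuousOn_const
  intro x hx
  exact sub_eq_zero.1 (abs_eq_zero.1 (this hx))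

theorem IsMild.transport_sub (hK : ContDiff ℝ 2 K) (h₁ : IsMild K ΦF S w₁)
    (h₂ : IsMild K ΦF S w₂) {τ : ℝ} (hτ : 0 ≤ τ) (r x : ℝ) (hr : 0 ≤ r) (hx : 0 ≤ x)
    (hS : τ + r ≤ S) (hx1 : x + r < 1) :
    (w₁ (τ + r) (x + r) - w₂ (τ + r) (x + r)) - (w₁ τ x - w₂ τ x) =
      ∫ s in (0 : ℝ)..r, (deriv K (cumul w₁ (τ + s) (x + s)) * w₁ (τ + s) (x + s) -
        deriv K (cumul w₂ (τ + s) (x + s)) * w₂ (τ + s) (x + s)) := by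
  have hl : Continuous fun s : ℝ => (τ + s, x + s) := by fun_prop
  have hs : ∀ w : ℝ → ℝ → ℝ, Continuous (Function.uncurry w) → IntervalIntegrable (fun s =>
      deriv K (cumul w (τ + s) (x + s)) * w (τ + s) (x + s)) volume 0 r := fun w hw =>
    ((continuous_source hK hw).comp hl).intervalIntegrable _ _
  rw [integral_sub (hs w₁ h₁.continuous) (hs w₂ h₂.continuous),
    ← h₁.transport τ x r hτ hr hx hS hx1, ← h₂.transport τ x r hτ hr hx hS hx1]
  ring

/-- This periodicity of the difference is what cancels inflow against outflow in both `L¹`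
estimates. -/
theorem IsMild.sub_boundary (h₁ : IsMild K ΦF S w₁) (h₂ : IsMild K ΦF S w₂) {τ : ℝ}
    (hτ : τ ∈ Icc 0 S) : w₁ τ 0 - w₂ τ 0 = w₁ τ 1 - w₂ τ 1 := by
  rw [h₁.boundary τ hτ, h₂.boundary τ hτ]; ring

/-- Two mild solutions with nonnegative densities separate exponentially at rate `kMin`. -/
theorem IsMild.distL1_growth (hK : IsPhaseResponse K ΦF) (h₁ : IsMild K ΦF S w₁)
    (h₂ : IsMild K ΦF S w₂) (hp₁ : ∀ τ ∈ Icc 0 S, ∀ x ∈ Icc (0 : ℝ) 1, 0 ≤ w₁ τ x)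
    (hp₂ : ∀ τ ∈ Icc 0 S, ∀ x ∈ Icc (0 : ℝ) 1, 0 ≤ w₂ τ x) {τ : ℝ} (hτ : τ ∈ Icc 0 S) :
    distL1 w₁ w₂ 0 * Real.exp (kMin K ΦF * τ) ≤ distL1 w₁ w₂ τ := by
  have hf : Continuous (Function.uncurry fun τ x =>
      deriv K (cumul w₁ τ x) * w₁ τ x - deriv K (cumul w₂ τ x) * w₂ τ x) :=
    (continuous_source hK.contDiff h₁.continuous).sub
      (continuous_source hK.contDiff h₂.continuous)
  have hz : Continuous (Function.uncurry fun τ x => w₁ τ x - w₂ τ x) :=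
    h₁.continuous.sub h₂.continuous
  have := le_gronwallBound_of_liminf_deriv_right_le (f := fun τ => -distL1 w₁ w₂ τ)
    (f' := fun τ => -∫ x in (0 : ℝ)..1, sgn (w₁ τ x - w₂ τ x) *
      (deriv K (cumul w₁ τ x) * w₁ τ x - deriv K (cumul w₂ τ x) * w₂ τ x))
    (δ := -distL1 w₁ w₂ 0) (K := kMin K ΦF) (ε := 0) (a := 0) (b := S)
    (continuous_distL1 h₁.continuous h₂.continuous).neg.continuousOn
    (fun t ht r hr => ?_) le_rfl (fun t ht => ?_) τ hτ
  · rw [gronwallBound_ε0, sub_zero] at this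
    linarith
  -- The convexity inequality `|b| ≥ |a| + sgn a * (b - a)` gives the lower bound for the slope of
  -- the `L¹` distance.
  · have := eventually_lt_integral_sub_of_transport (η := 1) (φ := fun x => |x|)
      (m := fun a d => sgn a * d) hz hf ht.2 one_pos le_rfl
      (h₁.transport_sub hK.contDiff h₂ ht.1) continuous_abs
      ((measurable_sgn.comp measurable_fst).mul measurable_snd)
      (fun a b => ?_) (fun _ _ _ _ => by ring) (fun a d d' => ?_) (r := -r) ?_
    · refine Eventually.frequently ?_
      filter_upwards [this, self_mem_nhdsWithin] with s hs hst
      rw [inv_mul_lt_iff₀ (sub_pos.2 hst)]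
      simp only [distL1]
      linarith
    · rw [mul_sub, sgn_mul_self]
      have : sgn a * b ≤ |b| := (le_abs_self _).trans (by
        rw [abs_mul]; exact mul_le_of_le_one_left (abs_nonneg _) (abs_sgn_le _))
      linarith
    · rw [← mul_sub, abs_mul]
      exact mul_le_of_le_one_left (abs_nonneg _) (abs_sgn_le _)
    · rw [h₁.sub_boundary h₂ (Ico_subset_Icc_self ht)]
      linarith
  · have ht' := Ico_subset_Icc_self ht
    have := kMin_mul_le (ΦF := ΦF) hK.contDiff (h₁.continuous.uncurry_left t)
      (h₂.continuous.uncurry_left t) (hp₁ t ht') (hp₂ t ht') (h₁.mass hK ht') (h₂.mass hK ht')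
    rw [add_zero, mul_neg]
    exact neg_le_neg this

/-- Mild solutions are determined by their initial densities. -/
theorem IsMild.unique (hK : IsPhaseResponse K ΦF) (h₁ : IsMild K ΦF S w₁)
    (h₂ : IsMild K ΦF S w₂) (h0 : EqOn (w₁ 0) (w₂ 0) (Icc 0 1)) {τ : ℝ} (hτ : τ ∈ Icc 0 S) :
    EqOn (w₁ τ) (w₂ τ) (Icc 0 1) := by
  refine eqOn_of_distL1_eq_zero h₁.continuous h₂.continuous
    (le_antisymm ?_ (distL1_nonneg τ))
  obtain ⟨C, hC⟩ := hK.bounded_deriv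
  obtain ⟨C₂, hC₂⟩ := hK.bounded_deriv_two
  have hC₂0 : 0 ≤ C₂ := (abs_nonneg _).trans (hC₂ 0)
  obtain ⟨W, hW⟩ := ((isCompact_Icc (a := (0 : ℝ)) (b := S)).prod
    (isCompact_Icc (a := (0 : ℝ)) (b := 1))).exists_bound_of_continuousOn
    h₂.continuous.continuousOn
  have hf : Continuous (Function.uncurry fun τ x =>
      deriv K (cumul w₁ τ x) * w₁ τ x - deriv K (cumul w₂ τ x) * w₂ τ x) :=
    (continuous_source hK.contDiff h₁.continuous).sub
      (continuous_source hK.contDiff h₂.continuous)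
  have hz : Continuous (Function.uncurry fun τ x => w₁ τ x - w₂ τ x) :=
    h₁.continuous.sub h₂.continuous
  have := le_gronwallBound_of_liminf_deriv_right_le (f := distL1 w₁ w₂)
    (f' := fun τ => ∫ x in (0 : ℝ)..1,
      |deriv K (cumul w₁ τ x) * w₁ τ x - deriv K (cumul w₂ τ x) * w₂ τ x|)
    (δ := 0) (K := C + C₂ * W) (ε := 0) (a := 0) (b := S)
    (continuous_distL1 h₁.continuous h₂.continuous).continuousOn
    (fun t ht r hr => ?_) ?_ (fun t ht => ?_) τ hτ
  · rwa [gronwallBound_ε0, zero_mul] at this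
  -- Applied to `-|z|`, the lower slope bound becomes an upper one for the `L¹` distance.
  · have := eventually_lt_integral_sub_of_transport (η := 1) (φ := fun x => -|x|)
      (m := fun a d => -|d|) hz hf ht.2 one_pos le_rfl
      (h₁.transport_sub hK.contDiff h₂ ht.1) continuous_abs.neg
      measurable_snd.abs.neg
      (fun a b => ?_) (fun _ d h hh => by rw [abs_mul, abs_of_nonneg hh]; ring)
      (fun a d d' => ?_) (r := -r) ?_
    · refine Eventually.frequently ?_
      filter_upwards [this, self_mem_nhdsWithin] with s hs hst
      rw [inv_mul_lt_iff₀ (sub_pos.2 hst)]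
      rw [intervalIntegral.integral_neg, intervalIntegral.integral_neg] at hs
      simp only [distL1]
      linarith
    · linarith [abs_sub_abs_le_abs_sub b a]
    · have e : -|d| - -|d'| = -(|d| - |d'|) := by ring
      rw [e, abs_neg]
      exact abs_abs_sub_abs_le d d'
    · rw [h₁.sub_boundary h₂ (Ico_subset_Icc_self ht), intervalIntegral.integral_neg]
      linarith
  · refine le_of_eq ?_
    rw [distL1, integral_congr (g := fun _ => 0) fun x hx => ?_]
    · simp
    · rw [uIcc_of_le zero_le_one] at hx
      simp [h0 hx]
  · have ht' := Ico_subset_Icc_self ht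
    have hi : ∀ a b, IntervalIntegrable (fun x => w₁ t x - w₂ t x) volume a b := fun a b =>
      (hz.uncurry_left t).intervalIntegrable a b
    have hD : ∀ x ∈ Icc (0 : ℝ) 1, |cumul w₁ t x - cumul w₂ t x| ≤ distL1 w₁ w₂ t := by
      intro x hx
      rw [cumul, cumul, ← integral_sub ((h₁.continuous.uncurry_left t).intervalIntegrable _ _)
        ((h₂.continuous.uncurry_left t).intervalIntegrable _ _)]
      refine (abs_integral_le_integral_abs hx.1).trans ?_
      rw [distL1, ← integral_add_adjacent_intervals (hi 0 x).abs (hi x 1).abs]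
      exact le_add_of_nonneg_right (integral_nonneg hx.2 fun _ _ => abs_nonneg _)
    have hle : ∀ x ∈ Icc (0 : ℝ) 1,
        |deriv K (cumul w₁ t x) * w₁ t x - deriv K (cumul w₂ t x) * w₂ t x| ≤
          C * |w₁ t x - w₂ t x| + C₂ * W * distL1 w₁ w₂ t := by
      intro x hx
      have e : deriv K (cumul w₁ t x) * w₁ t x - deriv K (cumul w₂ t x) * w₂ t x =
          deriv K (cumul w₁ t x) * (w₁ t x - w₂ t x) +
            (deriv K (cumul w₁ t x) - deriv K (cumul w₂ t x)) * w₂ t x := by ring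
      rw [e]
      refine (abs_add_le _ _).trans (add_le_add ?_ ?_)
      · rw [abs_mul]
        exact mul_le_mul_of_nonneg_right (hC _) (abs_nonneg _)
      · rw [abs_mul]
        have hW' : |w₂ t x| ≤ W := hW (t, x) ⟨ht', hx⟩
        have hl : |deriv K (cumul w₁ t x) - deriv K (cumul w₂ t x)| ≤
            C₂ * |cumul w₁ t x - cumul w₂ t x| :=
          abs_deriv_sub_le hK.contDiff hC₂ _ _
        calc _ ≤ C₂ * distL1 w₁ w₂ t * W :=
              mul_le_mul (hl.trans (mul_le_mul_of_nonneg_left (hD x hx) hC₂0)) hW'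
                (abs_nonneg _) (mul_nonneg hC₂0 (distL1_nonneg t))
          _ = C₂ * W * distL1 w₁ w₂ t := by ring
    have := integral_mono_on zero_le_one ((hf.uncurry_left t).abs.intervalIntegrable 0 1)
      (((hi 0 1).abs.const_mul C).add intervalIntegrable_const) hle
    rw [integral_add ((hi 0 1).abs.const_mul C) intervalIntegrable_const,
      intervalIntegral.integral_const_mul] at this
    rw [add_zero, add_mul]
    simpa [distL1] using this

/-- A mild solution which starts and enters with nonnegative density keeps it nonnegative. -/
theorem IsMild.nonneg (hK : ContDiff ℝ 2 K) (h : IsMild K ΦF S w)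
    (h0 : ∀ x ∈ Icc (0 : ℝ) 1, 0 ≤ w 0 x) (hb : ∀ τ ∈ Icc 0 S, 0 ≤ w τ 0) :
    ∀ τ ∈ Icc 0 S, ∀ x ∈ Icc (0 : ℝ) 1, 0 ≤ w τ x := by
  have hprop : ∀ τ x r, 0 ≤ τ → 0 ≤ r → 0 ≤ x → τ + r ≤ S → x + r < 1 → 0 ≤ w τ x →
      0 ≤ w (τ + r) (x + r) := by
    intro τ x r hτ hr hx hS hx1 h0
    have hl : Continuous fun s : ℝ => (τ + s, x + s) := by fun_prop
    have hac : Continuous fun s => deriv K (cumul w (τ + s) (x + s)) :=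
      (continuous_deriv_of_contDiff_two hK).comp ((continuous_cumul h.continuous).comp hl)
    have huc : Continuous fun s => w (τ + s) (x + s) := h.continuous.comp hl
    set A : ℝ → ℝ := fun s => ∫ t in (0 : ℝ)..s, deriv K (cumul w (τ + t) (x + t)) with hA
    have hAd := fun s => hasDerivAt_primitive hac 0 s
    have hud : ∀ s, HasDerivAt (fun s => w τ x + ∫ t in (0 : ℝ)..s,
        deriv K (cumul w (τ + t) (x + t)) * w (τ + t) (x + t))
        (deriv K (cumul w (τ + s) (x + s)) * w (τ + s) (x + s)) s := fun s =>
      (hasDerivAt_primitive (hac.mul huc) 0 s).const_add _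
    have hu : ∀ s ∈ Icc 0 r, w (τ + s) (x + s) = w τ x + ∫ t in (0 : ℝ)..s,
        deriv K (cumul w (τ + t) (x + t)) * w (τ + t) (x + t) := fun s hs => by
      rw [← h.transport τ x s hτ hs.1 hx (by linarith [hs.2]) (by linarith [hs.2])]
      ring
    have hvd : ∀ s, HasDerivAt (fun s => (w τ x + ∫ t in (0 : ℝ)..s,
        deriv K (cumul w (τ + t) (x + t)) * w (τ + t) (x + t)) * Real.exp (-A s))
        (deriv K (cumul w (τ + s) (x + s)) * w (τ + s) (x + s) * Real.exp (-A s) +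
          (w τ x + ∫ t in (0 : ℝ)..s,
            deriv K (cumul w (τ + t) (x + t)) * w (τ + t) (x + t)) *
            (Real.exp (-A s) * -deriv K (cumul w (τ + s) (x + s)))) s := fun s =>
      (hud s).mul (hAd s).neg.exp
    -- Along a characteristic the density solves a linear equation, so its product with the
    -- integrating factor `exp (-A)` is constant.
    have hconst := constant_of_has_deriv_right_zero (a := 0) (b := r)
      (fun s _ => (hvd s).continuousAt.continuousWithinAt) (fun s hs => by
        have e := (hvd s).hasDerivWithinAt (s := Ici s)
        convert e using 1
        rw [hu s (Ico_subset_Icc_self hs)]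
        ring) r (right_mem_Icc.2 hr)
    rw [← hu r (right_mem_Icc.2 hr)] at hconst
    simp only [integral_same, add_zero, hA, neg_zero, Real.exp_zero, mul_one] at hconst
    exact nonneg_of_mul_nonneg_left (hconst ▸ h0) (Real.exp_pos _)
  have hlt : ∀ τ ∈ Icc 0 S, ∀ x ∈ Ico (0 : ℝ) 1, 0 ≤ w τ x := by
    intro τ hτ x hx
    -- The characteristic through `(τ, x)` is traced back to the initial line or to the entering
    -- boundary.
    rcases le_total τ x with hle | hle
    · have := hprop 0 (x - τ) τ le_rfl hτ.1 (by linarith) (by linarith [hτ.2])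
        (by linarith [hx.2]) (h0 _ ⟨by linarith, by linarith [hτ.1, hx.2]⟩)
      simpa using this
    · have := hprop (τ - x) 0 x (by linarith) hx.1 le_rfl (by linarith [hτ.2])
        (by linarith [hx.2]) (hb _ ⟨by linarith, by linarith [hτ.2, hx.1]⟩)
      simpa using this
  intro τ hτ x hx
  -- The transport law is stated only for end points below `1`; the value at `1` follows by
  -- continuity.
  have hcl : IsClosed {y | 0 ≤ w τ y} :=
    isClosed_le continuous_const (h.continuous.uncurry_left τ)
  have hsub : closure (Ico (0 : ℝ) 1) ⊆ {y | 0 ≤ w τ y} :=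
    closure_minimal (hlt τ hτ) hcl
  rw [closure_Ico zero_ne_one] at hsub
  exact hsub hx

end Compare

/-! ### Global existence of mild solutions by a weighted contraction -/

theorem abs_integral_le_of_le_exp {g : ℝ → ℝ} {a b A l : ℝ} (hl : 0 < l) (hA : 0 ≤ A)
    (hab : a ≤ b) (h : ∀ r ∈ Icc a b, |g r| ≤ A * Real.exp (l * r)) :
    |∫ r in a..b, g r| ≤ A / l * Real.exp (l * b) := by
  have hc : Continuous fun r => A * Real.exp (l * r) := by fun_prop
  have h1 := norm_integral_le_of_norm_le (μ := volume) (f := g) hab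
    (Eventually.of_forall fun r hr => h r (Ioc_subset_Icc_self hr)) (hc.intervalIntegrable a b)
  have h2 : ∫ r in a..b, A * Real.exp (l * r) =
      A / l * Real.exp (l * b) - A / l * Real.exp (l * a) := by
    refine integral_eq_sub_of_hasDerivAt (f := fun r => A / l * Real.exp (l * r))
      (fun r _ => ?_) (hc.intervalIntegrable a b)
    refine ((((hasDerivAt_id' r).const_mul l).exp).const_mul (A / l)).congr_deriv ?_
    field_simp
  rw [h2] at h1
  have : 0 ≤ A / l * Real.exp (l * a) := by positivity
  rw [Real.norm_eq_abs] at h1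
  linarith

/-- The entering and source terms of the mild formulation contract the weighted supremum norm with
weight `(1 + 3 η) exp (-l τ)`. -/
theorem weighted_estimate {Δ H : ℝ → ℝ → ℝ} {M d L l : ℝ} (hd : 0 ≤ d) (hL : 0 ≤ L)
    (hl3 : 3 ≤ l) (hlL : 16 * L ≤ l)
    (hΔ : ∀ τ ∈ Icc 0 M, ∀ x ∈ Icc (0 : ℝ) 1, (1 + 3 * x) * |Δ τ x| ≤ d * Real.exp (l * τ))
    (hH : ∀ τ ∈ Icc 0 M, ∀ x ∈ Icc (0 : ℝ) 1, |H τ x| ≤ L * d * Real.exp (l * τ))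
    {τ η : ℝ} (hτ : τ ∈ Icc 0 M) (hη : η ∈ Icc (0 : ℝ) 1) :
    (1 + 3 * η) * |Δ (max (τ - η) 0) 1 - Δ 0 1 +
      ∫ r in (max (τ - η) 0)..τ, H r (η - τ + r)| ≤ 3 / 4 * (d * Real.exp (l * τ)) := by
  have hl : 0 < l := by linarith
  have hM : 0 ≤ M := hτ.1.trans hτ.2
  have hint : |∫ r in (max (τ - η) 0)..τ, H r (η - τ + r)| ≤ d * Real.exp (l * τ) / 16 := by
    refine (abs_integral_le_of_le_exp hl (mul_nonneg hL hd)
      (max_le (by linarith [hη.1]) hτ.1) fun r hr => ?_).trans ?_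
    · have h1 := (le_max_left _ _).trans hr.1
      have h2 := (le_max_right _ _).trans hr.1
      exact hH r ⟨h2, hr.2.trans hτ.2⟩ _ ⟨by linarith, by linarith [hr.2, hη.2]⟩
    · have : L * d / l ≤ d / 16 := by
        rw [div_le_div_iff₀ hl (by norm_num)]
        nlinarith
      have := mul_le_mul_of_nonneg_right this (Real.exp_pos (l * τ)).le
      linarith
  have hE : 0 ≤ d * Real.exp (l * τ) := by positivity
  have hη4 : 1 + 3 * η ≤ 4 := by linarith [hη.2]
  have hη0 : 0 ≤ 1 + 3 * η := by linarith [hη.1]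
  have hI : (1 + 3 * η) * |∫ r in (max (τ - η) 0)..τ, H r (η - τ + r)| ≤
      1 / 4 * (d * Real.exp (l * τ)) := by
    calc _ ≤ 4 * (d * Real.exp (l * τ) / 16) :=
          mul_le_mul hη4 hint (abs_nonneg _) (by norm_num)
      _ = _ := by ring
  -- The trace at `1` carries weight `4`, so each of the two trace terms costs a quarter. The factor
  -- `1 + 3 η` at the arrival point is absorbed by `exp (l η)`, because `l ≥ 3`. Together with the
  -- quarter from the source this gives `3 / 4`.
  have hB : (1 + 3 * η) * |Δ (max (τ - η) 0) 1 - Δ 0 1| ≤ 1 / 2 * (d * Real.exp (l * τ)) := by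
    rcases le_total τ η with h | h
    · rw [max_eq_right (by linarith), sub_self, abs_zero, mul_zero]
      linarith
    · rw [max_eq_left (by linarith)]
      have h1 := hΔ (τ - η) ⟨by linarith, by linarith [hτ.2, hη.1]⟩ 1 ⟨zero_le_one, le_rfl⟩
      have h0 := hΔ 0 ⟨le_rfl, hM⟩ 1 ⟨zero_le_one, le_rfl⟩
      have he : Real.exp (l * 0) ≤ Real.exp (l * (τ - η)) :=
        Real.exp_le_exp.2 (mul_le_mul_of_nonneg_left (by linarith) hl.le)
      have h0' := mul_le_mul_of_nonneg_left he hd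
      have h3 : |Δ (τ - η) 1 - Δ 0 1| ≤ 1 / 2 * (d * Real.exp (l * (τ - η))) := by
        refine (abs_sub _ _).trans ?_
        linarith
      have h4 : (1 + 3 * η) * Real.exp (l * (τ - η)) ≤ Real.exp (l * τ) := by
        have e : l * τ = l * η + l * (τ - η) := by ring
        rw [e, Real.exp_add]
        refine mul_le_mul_of_nonneg_right ?_ (Real.exp_pos _).le
        have := Real.add_one_le_exp (l * η)
        nlinarith [hη.1]
      calc _ ≤ (1 + 3 * η) * (1 / 2 * (d * Real.exp (l * (τ - η)))) :=
            mul_le_mul_of_nonneg_left h3 hη0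
        _ = 1 / 2 * (d * ((1 + 3 * η) * Real.exp (l * (τ - η)))) := by ring
        _ ≤ _ := by
            refine mul_le_mul_of_nonneg_left (mul_le_mul_of_nonneg_left h4 hd) (by norm_num)
  calc _ ≤ (1 + 3 * η) * (|Δ (max (τ - η) 0) 1 - Δ 0 1| +
        |∫ r in (max (τ - η) 0)..τ, H r (η - τ + r)|) :=
        mul_le_mul_of_nonneg_left (abs_add_le _ _) hη0
    _ ≤ _ := by rw [mul_add]; linarith

/-- Truncation of a real number to `[-R, R]`. -/
def trunc (R y : ℝ) : ℝ := max (-R) (min R y)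

theorem continuous_trunc (R : ℝ) : Continuous (trunc R) := by
  unfold trunc
  fun_prop

theorem abs_trunc_sub_le (R a b : ℝ) : |trunc R a - trunc R b| ≤ |a - b| := by
  unfold trunc
  calc _ ≤ |min R a - min R b| := by
        simpa using abs_max_sub_max_le_max (-R) (min R a) (-R) (min R b)
    _ ≤ _ := by simpa using abs_min_sub_min_le_max R a R b

theorem abs_trunc_le {R : ℝ} (hR : 0 ≤ R) (a : ℝ) : |trunc R a| ≤ R :=
  abs_le.2 ⟨le_max_left _ _, max_le (by linarith) (min_le_left _ _)⟩

theorem abs_trunc_le_abs {R : ℝ} (hR : 0 ≤ R) (a : ℝ) : |trunc R a| ≤ |a| := by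
  have h0 : trunc R 0 = 0 := by simp [trunc, hR]
  simpa [h0] using abs_trunc_sub_le R a 0

theorem trunc_eq {R a : ℝ} (h : |a| ≤ R) : trunc R a = a := by
  rw [abs_le] at h
  rw [trunc, min_eq_right h.2, max_eq_right h.1]

/-- The source term with truncated density. -/
def truncSource (K : ℝ → ℝ) (R : ℝ) (w : ℝ → ℝ → ℝ) (τ x : ℝ) : ℝ :=
  deriv K (cumul w τ x) * trunc R (w τ x)

/-- The map whose fixed points are the mild solutions with initial density `p`. -/
def mildMap (K : ℝ → ℝ) (R : ℝ) (p : ℝ → ℝ) (w : ℝ → ℝ → ℝ) (τ η : ℝ) : ℝ :=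
  p (max (η - τ) 0) + (w (max (τ - η) 0) 1 - w 0 1 +
    ∫ r in (max (τ - η) 0)..τ, truncSource K R w r (η - τ + r))

section Existence

variable {K : ℝ → ℝ} {ΦF R : ℝ} {p : ℝ → ℝ} {w w₁ w₂ : ℝ → ℝ → ℝ}

theorem continuous_truncSource (hK : ContDiff ℝ 2 K) (hw : Continuous (Function.uncurry w)) :
    Continuous (Function.uncurry (truncSource K R w)) :=
  ((continuous_deriv_of_contDiff_two hK).comp (continuous_cumul hw)).mul
    ((continuous_trunc R).comp hw)

theorem intervalIntegrable_truncSource (hK : ContDiff ℝ 2 K)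
    (hw : Continuous (Function.uncurry w)) (s a b : ℝ) :
    IntervalIntegrable (fun r => truncSource K R w r (s + r)) volume a b :=
  ((continuous_truncSource hK hw).comp
    (continuous_id.prodMk (continuous_const.add continuous_id))).intervalIntegrable _ _

theorem continuous_mildMap (hK : ContDiff ℝ 2 K) (hp : Continuous p)
    (hw : Continuous (Function.uncurry w)) :
    Continuous (Function.uncurry (mildMap K R p w)) := by
  have hs := continuous_truncSource (R := R) hK hw
  have hi : ∀ g : ℝ × ℝ → ℝ, Continuous g → Continuous fun q : ℝ × ℝ =>
      ∫ r in (0 : ℝ)..(g q), truncSource K R w r (q.2 - q.1 + r) := fun g hg =>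
    intervalIntegral.continuous_parametric_intervalIntegral_of_continuous (μ := volume) (a₀ := 0)
      (f := fun (q : ℝ × ℝ) r => truncSource K R w r (q.2 - q.1 + r)) (s := g)
      (hs.comp (f := fun y : (ℝ × ℝ) × ℝ => (y.2, y.1.2 - y.1.1 + y.2)) (by fun_prop)) hg
  have e : Function.uncurry (mildMap K R p w) = fun q : ℝ × ℝ =>
      p (max (q.2 - q.1) 0) + (w (max (q.1 - q.2) 0) 1 - w 0 1 +
        ((∫ r in (0 : ℝ)..q.1, truncSource K R w r (q.2 - q.1 + r)) -
          ∫ r in (0 : ℝ)..(max (q.1 - q.2) 0), truncSource K R w r (q.2 - q.1 + r))) := by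
    ext ⟨τ, η⟩
    simp only [Function.uncurry, mildMap]
    rw [integral_interval_sub_left (intervalIntegrable_truncSource hK hw _ _ _)
      (intervalIntegrable_truncSource hK hw _ _ _)]
  rw [e]
  have h1 : Continuous fun q : ℝ × ℝ => w (max (q.1 - q.2) 0) 1 :=
    (hw.uncurry_right 1).comp (by fun_prop)
  exact (hp.comp (by fun_prop)).add
    ((h1.sub continuous_const).add ((hi _ continuous_fst).sub (hi _ (by fun_prop))))

theorem abs_cumul_sub_le {τ x D : ℝ} (h₁ : Continuous (Function.uncurry w₁))
    (h₂ : Continuous (Function.uncurry w₂)) (hx : x ∈ Icc (0 : ℝ) 1)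
    (h : ∀ y ∈ Icc (0 : ℝ) 1, |w₁ τ y - w₂ τ y| ≤ D) : |cumul w₁ τ x - cumul w₂ τ x| ≤ D := by
  have hD : 0 ≤ D := (abs_nonneg _).trans (h 0 (left_mem_Icc.2 zero_le_one))
  rw [cumul, cumul, ← integral_sub ((h₁.uncurry_left τ).intervalIntegrable _ _)
    ((h₂.uncurry_left τ).intervalIntegrable _ _)]
  have := norm_integral_le_of_norm_le_const (a := 0) (b := x) (C := D)
    (f := fun y => w₁ τ y - w₂ τ y) fun y hy => by
      rw [uIoc_of_le hx.1] at hy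
      exact h y ⟨hy.1.le, hy.2.trans hx.2⟩
  rw [Real.norm_eq_abs, sub_zero, abs_of_nonneg hx.1] at this
  exact this.trans (mul_le_of_le_one_right hD hx.2)

theorem abs_truncSource_sub_le {C C₂ τ x D : ℝ} (hK : ContDiff ℝ 2 K)
    (hC : ∀ x, |deriv K x| ≤ C) (hC₂ : ∀ x, |iteratedDeriv 2 K x| ≤ C₂) (hR : 0 ≤ R)
    (h₁ : Continuous (Function.uncurry w₁)) (h₂ : Continuous (Function.uncurry w₂))
    (hx : x ∈ Icc (0 : ℝ) 1) (h : ∀ y ∈ Icc (0 : ℝ) 1, |w₁ τ y - w₂ τ y| ≤ D) :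
    |truncSource K R w₁ τ x - truncSource K R w₂ τ x| ≤ (C + C₂ * R) * D := by
  have hC0 : 0 ≤ C := (abs_nonneg _).trans (hC 0)
  have hC₂0 : 0 ≤ C₂ := (abs_nonneg _).trans (hC₂ 0)
  have hD : 0 ≤ D := (abs_nonneg _).trans (h 0 (left_mem_Icc.2 zero_le_one))
  have e : truncSource K R w₁ τ x - truncSource K R w₂ τ x =
      deriv K (cumul w₁ τ x) * (trunc R (w₁ τ x) - trunc R (w₂ τ x)) +
        (deriv K (cumul w₁ τ x) - deriv K (cumul w₂ τ x)) * trunc R (w₂ τ x) := by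
    simp only [truncSource]; ring
  rw [e]
  refine (abs_add_le _ _).trans ?_
  rw [abs_mul, abs_mul, add_mul]
  refine add_le_add ?_ ?_
  · exact mul_le_mul (hC _) ((abs_trunc_sub_le _ _ _).trans (h x hx)) (abs_nonneg _) hC0
  · calc _ ≤ C₂ * D * R := mul_le_mul ((abs_deriv_sub_le hK hC₂ _ _).trans
          (mul_le_mul_of_nonneg_left (abs_cumul_sub_le h₁ h₂ hx h) hC₂0)) (abs_trunc_le hR _)
          (abs_nonneg _) (mul_nonneg hC₂0 hD)
      _ = C₂ * R * D := by ring

/-- The function on the plane which corresponds to `v` under the exponential change of unknown,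
extended constantly beyond `[0, M] × [0, 1]`. -/
def unweight {M : ℝ} (hM : 0 ≤ M) (l : ℝ) (v : C(Icc 0 M × Icc (0 : ℝ) 1, ℝ)) (τ η : ℝ) : ℝ :=
  Real.exp (l * projIcc 0 M hM τ) / (1 + 3 * (projIcc 0 1 zero_le_one η : ℝ)) *
    v (projIcc 0 M hM τ, projIcc 0 1 zero_le_one η)

theorem continuous_unweight {M : ℝ} (hM : 0 ≤ M) (l : ℝ) (v : C(Icc 0 M × Icc (0 : ℝ) 1, ℝ)) :
    Continuous (Function.uncurry (unweight hM l v)) := by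
  have h1 : Continuous fun q : ℝ × ℝ => projIcc 0 M hM q.1 := continuous_projIcc.comp continuous_fst
  have h2 : Continuous fun q : ℝ × ℝ => projIcc (0 : ℝ) 1 zero_le_one q.2 :=
    continuous_projIcc.comp continuous_snd
  refine Continuous.mul (Continuous.div (by fun_prop) (by fun_prop) fun q => ?_)
    (v.continuous.comp (h1.prodMk h2))
  have := (projIcc (0 : ℝ) 1 zero_le_one q.2).2.1
  positivity

/-- Multiplication by `(1 + 3 η) exp (-l τ)` turns `mildMap` into a contraction for the supremum
norm on all of `[0, M] × [0, 1]`, so no short intervals have to be glued. Truncation makes the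
source globally Lipschitz: the variation of `K'` is multiplied by a density bounded by `R`.
Subtracting `w 0 1` in `mildMap` makes it continuous across `η = τ` for every continuous `w`. -/
theorem exists_mildMap_fixed (hK : IsPhaseResponse K ΦF) (hp : Continuous p) (hR : 0 ≤ R) {M : ℝ}
    (hM : 0 ≤ M) : ∃ w : ℝ → ℝ → ℝ, Continuous (Function.uncurry w) ∧
      ∀ τ ∈ Icc 0 M, ∀ η ∈ Icc (0 : ℝ) 1, w τ η = mildMap K R p w τ η := by
  obtain ⟨C, hC⟩ := hK.bounded_deriv
  obtain ⟨C₂, hC₂⟩ := hK.bounded_deriv_two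
  have hC0 : 0 ≤ C := (abs_nonneg _).trans (hC 0)
  have hC₂0 : 0 ≤ C₂ := (abs_nonneg _).trans (hC₂ 0)
  set L := C + C₂ * R with hL
  have hL0 : 0 ≤ L := by positivity
  set l := 3 + 16 * L with hl
  let T : C(Icc 0 M × Icc (0 : ℝ) 1, ℝ) → C(Icc 0 M × Icc (0 : ℝ) 1, ℝ) := fun v =>
    ⟨fun q => Real.exp (-(l * q.1)) * (1 + 3 * (q.2 : ℝ)) *
      mildMap K R p (unweight hM l v) q.1 q.2, by
        have := (continuous_mildMap (R := R) hK.contDiff hp (continuous_unweight hM l v)).comp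
          (f := fun q : Icc 0 M × Icc (0 : ℝ) 1 => ((q.1 : ℝ), (q.2 : ℝ))) (by fun_prop)
        exact Continuous.mul (by fun_prop) this⟩
  have hval : ∀ v : C(Icc 0 M × Icc (0 : ℝ) 1, ℝ), ∀ τ (hτ : τ ∈ Icc 0 M) x
      (hx : x ∈ Icc (0 : ℝ) 1), (1 + 3 * x) * unweight hM l v τ x =
        Real.exp (l * τ) * v (⟨τ, hτ⟩, ⟨x, hx⟩) := by
    intro v τ hτ x hx
    have : 1 + 3 * x ≠ 0 := by linarith [hx.1]
    rw [unweight, projIcc_of_mem hM hτ, projIcc_of_mem zero_le_one hx]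
    field_simp
  have hlip : LipschitzWith (3 / 4) T := by
    refine LipschitzWith.of_dist_le_mul fun v v' => ?_
    rw [ContinuousMap.dist_le (by positivity)]
    rintro ⟨⟨τ, hτ⟩, ⟨η, hη⟩⟩
    have hd : ∀ τ ∈ Icc 0 M, ∀ x ∈ Icc (0 : ℝ) 1,
        (1 + 3 * x) * |unweight hM l v τ x - unweight hM l v' τ x| ≤
          dist v v' * Real.exp (l * τ) := by
      intro τ hτ x hx
      have h0 : 0 ≤ 1 + 3 * x := by linarith [hx.1]
      rw [← abs_of_nonneg h0, ← abs_mul, mul_sub, hval v τ hτ x hx, hval v' τ hτ x hx, ← mul_sub,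
        abs_mul, Real.abs_exp, mul_comm]
      exact mul_le_mul_of_nonneg_right (ContinuousMap.dist_apply_le_dist (f := v) (g := v') _) (Real.exp_pos _).le
    have hd' : ∀ τ ∈ Icc 0 M, ∀ x ∈ Icc (0 : ℝ) 1,
        |unweight hM l v τ x - unweight hM l v' τ x| ≤ dist v v' * Real.exp (l * τ) :=
      fun τ hτ x hx => (le_mul_of_one_le_left (abs_nonneg _) (by linarith [hx.1])).trans
        (hd τ hτ x hx)
    have hw := continuous_unweight hM l v
    have hw' := continuous_unweight hM l v'
    have := weighted_estimate (M := M) (L := L) (l := l)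
      (Δ := fun τ x => unweight hM l v τ x - unweight hM l v' τ x)
      (H := fun τ x => truncSource K R (unweight hM l v) τ x -
        truncSource K R (unweight hM l v') τ x) (d := dist v v') dist_nonneg hL0
      (by linarith) (by linarith) hd (fun τ hτ x hx => by
        rw [mul_assoc]
        exact abs_truncSource_sub_le hK.contDiff hC hC₂ hR hw hw' hx (hd' τ hτ)) hτ hη
    rw [integral_sub (intervalIntegrable_truncSource hK.contDiff hw _ _ _)
      (intervalIntegrable_truncSource hK.contDiff hw' _ _ _)] at this
    have h0 : 0 ≤ Real.exp (-(l * τ)) * (1 + 3 * η) := by have := hη.1; positivity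
    change |Real.exp (-(l * τ)) * (1 + 3 * η) * mildMap K R p (unweight hM l v) τ η -
      Real.exp (-(l * τ)) * (1 + 3 * η) * mildMap K R p (unweight hM l v') τ η| ≤ _
    rw [← mul_sub, abs_mul, abs_of_nonneg h0, mul_assoc]
    have e : mildMap K R p (unweight hM l v) τ η - mildMap K R p (unweight hM l v') τ η =
        unweight hM l v (max (τ - η) 0) 1 - unweight hM l v' (max (τ - η) 0) 1 -
          (unweight hM l v 0 1 - unweight hM l v' 0 1) +
          ((∫ r in (max (τ - η) 0)..τ, truncSource K R (unweight hM l v) r (η - τ + r)) -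
            ∫ r in (max (τ - η) 0)..τ, truncSource K R (unweight hM l v') r (η - τ + r)) := by
      simp only [mildMap]; ring
    rw [e]
    refine (mul_le_mul_of_nonneg_left this (Real.exp_pos _).le).trans_eq ?_
    rw [Real.exp_neg]
    have := (Real.exp_pos (l * τ)).ne'
    push_cast
    field_simp
  have hcon : ContractingWith (3 / 4) T :=
    ⟨by rw [← NNReal.coe_lt_coe]; push_cast; norm_num, hlip⟩
  refine ⟨unweight hM l hcon.fixedPoint, continuous_unweight hM l _, fun τ hτ η hη => ?_⟩
  have hfix : T hcon.fixedPoint = hcon.fixedPoint := hcon.fixedPoint_isFixedPt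
  have h1 := hval hcon.fixedPoint τ hτ η hη
  have h2 := congrArg (fun v : C(Icc 0 M × Icc (0 : ℝ) 1, ℝ) => v (⟨τ, hτ⟩, ⟨η, hη⟩)) hfix
  change Real.exp (-(l * τ)) * (1 + 3 * η) * mildMap K R p _ τ η = _ at h2
  rw [← h2, Real.exp_neg] at h1
  have h3 := (Real.exp_pos (l * τ)).ne'
  have h4 : 1 + 3 * η ≠ 0 := by linarith [hη.1]
  field_simp at h1
  exact h1

/-- Fixed points of the truncated map satisfy a bound which does not depend on the truncation. -/
theorem abs_le_of_mildMap_fixed {C P M : ℝ} (hC : ∀ x, |deriv K x| ≤ C) (hR : 0 ≤ R)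
    (hP : ∀ x ∈ Icc (0 : ℝ) 1, |p x| ≤ P) (hM : 0 ≤ M) (hw : Continuous (Function.uncurry w))
    (hfix : ∀ τ ∈ Icc 0 M, ∀ η ∈ Icc (0 : ℝ) 1, w τ η = mildMap K R p w τ η) :
    ∀ τ ∈ Icc 0 M, ∀ η ∈ Icc (0 : ℝ) 1, |w τ η| ≤ 16 * P * Real.exp ((3 + 16 * C) * M) := by
  have hC0 : 0 ≤ C := (abs_nonneg _).trans (hC 0)
  have hP0 : 0 ≤ P := (abs_nonneg _).trans (hP 0 (left_mem_Icc.2 zero_le_one))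
  set l := 3 + 16 * C with hl
  obtain ⟨⟨τ₀, η₀⟩, ⟨hτ₀, hη₀⟩, hmax⟩ := ((isCompact_Icc (a := 0) (b := M)).prod
    (isCompact_Icc (a := (0 : ℝ)) (b := 1))).exists_isMaxOn
    ⟨(0, 0), ⟨le_rfl, hM⟩, le_rfl, zero_le_one⟩
    (f := fun q : ℝ × ℝ => Real.exp (-(l * q.1)) * ((1 + 3 * q.2) * |w q.1 q.2|))
    (Continuous.continuousOn (Continuous.mul (by fun_prop) (Continuous.mul (by fun_prop) hw.abs)))
  simp only at hτ₀ hη₀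
  set m := Real.exp (-(l * τ₀)) * ((1 + 3 * η₀) * |w τ₀ η₀|) with hm
  have hη₀0 : 0 ≤ 1 + 3 * η₀ := by linarith [hη₀.1]
  have hm0 : 0 ≤ m := by positivity
  have hbound : ∀ τ ∈ Icc 0 M, ∀ x ∈ Icc (0 : ℝ) 1,
      (1 + 3 * x) * |w τ x| ≤ m * Real.exp (l * τ) := by
    intro τ hτ x hx
    have h : Real.exp (-(l * τ)) * ((1 + 3 * x) * |w τ x|) ≤ m :=
      hmax (a := (τ, x)) ⟨hτ, hx⟩
    rw [Real.exp_neg, inv_mul_le_iff₀ (Real.exp_pos _)] at h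
    linarith
  have hbound' : ∀ τ ∈ Icc 0 M, ∀ x ∈ Icc (0 : ℝ) 1, |w τ x| ≤ m * Real.exp (l * τ) :=
    fun τ hτ x hx => (le_mul_of_one_le_left (abs_nonneg _) (by linarith [hx.1])).trans
      (hbound τ hτ x hx)
  have hest := weighted_estimate (L := C) (l := l) (H := truncSource K R w) hm0 hC0 (by linarith)
    (by linarith) hbound (fun τ hτ x hx => by
      rw [truncSource, abs_mul, mul_assoc]
      exact mul_le_mul (hC _) ((abs_trunc_le_abs hR _).trans (hbound' τ hτ x hx))
        (abs_nonneg _) hC0) hτ₀ hη₀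
  have hp₀ := hP (max (η₀ - τ₀) 0)
    ⟨le_max_right _ _, max_le (by linarith [hη₀.2, hτ₀.1]) zero_le_one⟩
  have hw₀ := hfix τ₀ hτ₀ η₀ hη₀
  rw [mildMap] at hw₀
  -- At a maximum point of the weighted modulus, the contraction estimate applied to `w` itself
  -- gives this bound, hence `m ≤ 16 * P`.
  have hmP : m ≤ 4 * P + 3 / 4 * m := by
    have h1 : (1 + 3 * η₀) * |w τ₀ η₀| ≤ 4 * P + 3 / 4 * (m * Real.exp (l * τ₀)) := by
      rw [hw₀]
      refine (mul_le_mul_of_nonneg_left (abs_add_le _ _) hη₀0).trans ?_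
      rw [mul_add]
      exact add_le_add (mul_le_mul (by linarith [hη₀.2]) hp₀ (abs_nonneg _) (by norm_num)) hest
    have h2 := mul_le_mul_of_nonneg_left h1 (Real.exp_pos (-(l * τ₀))).le
    have h3 : Real.exp (-(l * τ₀)) * Real.exp (l * τ₀) = 1 := by
      rw [← Real.exp_add]; simp
    have h4 : Real.exp (-(l * τ₀)) * (4 * P) ≤ 4 * P :=
      mul_le_of_le_one_left (by positivity)
        (Real.exp_le_one_iff.2 (neg_nonpos.2 (mul_nonneg (by positivity) hτ₀.1)))
    calc m ≤ _ := h2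
      _ = Real.exp (-(l * τ₀)) * (4 * P) +
          3 / 4 * m * (Real.exp (-(l * τ₀)) * Real.exp (l * τ₀)) := by ring
      _ ≤ _ := by rw [h3]; linarith
  intro τ hτ η hη
  refine (hbound' τ hτ η hη).trans (mul_le_mul (by linarith) ?_ (Real.exp_pos _).le (by positivity))
  exact Real.exp_le_exp.2 (mul_le_mul_of_nonneg_left hτ.2 (by positivity))

/-- Global existence of mild solutions. -/
theorem exists_isMild (hK : IsPhaseResponse K ΦF) (hp : Continuous p)
    (hcomp : p 0 = p 1 - K ΦF + K 0) (hmass : ∫ x in (0 : ℝ)..1, p x = ΦF) {M : ℝ} (hM : 0 ≤ M) :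
    ∃ w, IsMild K ΦF M w ∧ EqOn (w 0) p (Icc 0 1) := by
  obtain ⟨C, hC⟩ := hK.bounded_deriv
  obtain ⟨P, hP⟩ := (isCompact_Icc (a := (0 : ℝ)) (b := 1)).exists_bound_of_continuousOn
    hp.continuousOn
  have hP0 : 0 ≤ P := (norm_nonneg _).trans (hP 0 (left_mem_Icc.2 zero_le_one))
  have hR : 0 ≤ 16 * P * Real.exp ((3 + 16 * C) * M) := by positivity
  obtain ⟨w, hw, hfix⟩ := exists_mildMap_fixed hK hp hR hM
  have hle := abs_le_of_mildMap_fixed hC hR hP hM hw hfix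
  -- The truncation level equals the a priori bound, which does not depend on it, so the truncation
  -- is inactive at the fixed point.
  set R := 16 * P * Real.exp ((3 + 16 * C) * M)
  have hsrc : ∀ τ ∈ Icc 0 M, ∀ x ∈ Icc (0 : ℝ) 1,
      truncSource K R w τ x = deriv K (cumul w τ x) * w τ x := fun τ hτ x hx => by
    rw [truncSource, trunc_eq (hle τ hτ x hx)]
  have h0 : EqOn (w 0) p (Icc 0 1) := fun x hx => by
    rw [hfix 0 ⟨le_rfl, hM⟩ x hx, mildMap, sub_zero, max_eq_left hx.1,
      max_eq_right (by linarith [hx.1])]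
    simp
  refine ⟨w, ⟨hw, fun τ hτ => ?_, ?_, fun τ x h hτ hh hx hS hx1 => ?_⟩, h0⟩
  · rw [hfix τ hτ 0 (left_mem_Icc.2 zero_le_one), mildMap, sub_zero, max_eq_left hτ.1,
      max_eq_right (by linarith [hτ.1]), h0 (right_mem_Icc.2 zero_le_one), integral_same]
    linarith
  · rw [← hmass]
    refine integral_congr fun x hx => ?_
    rw [uIcc_of_le zero_le_one] at hx
    exact h0 hx
  · rw [hfix (τ + h) ⟨by linarith, hS⟩ (x + h) ⟨by linarith, hx1.le⟩,
      hfix τ ⟨hτ, by linarith⟩ x ⟨hx, by linarith⟩, mildMap, mildMap,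
      add_sub_add_right_eq_sub, add_sub_add_right_eq_sub]
    have e : (∫ r in (0 : ℝ)..h, deriv K (cumul w (τ + r) (x + r)) * w (τ + r) (x + r)) =
        ∫ r in τ..(τ + h), truncSource K R w r (x - τ + r) := by
      have := intervalIntegral.integral_comp_add_left (a := 0) (b := h)
        (fun r => truncSource K R w r (x - τ + r)) τ
      rw [add_zero] at this
      rw [← this]
      refine integral_congr fun r hr => ?_
      rw [uIcc_of_le hh] at hr
      rw [← hsrc (τ + r) ⟨by linarith [hr.1], by linarith [hr.2]⟩ (x + r)
        ⟨by linarith [hr.1], by linarith [hr.2]⟩]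
      congr 1
      ring
    have e' := integral_interval_sub_left (a := max (τ - x) 0) (b := τ + h) (c := τ)
      (intervalIntegrable_truncSource (R := R) hK.contDiff hw (x - τ) _ _)
      (intervalIntegrable_truncSource hK.contDiff hw (x - τ) _ _)
    rw [e, ← e']
    ring

end Existence

/-! ### From classical to mild solutions -/

theorem convex_timeInterval (T : EReal) : Convex ℝ (timeInterval T) := by
  refine OrdConnected.convex ⟨fun a ha b hb c hc => ⟨ha.1.trans hc.1, ?_⟩⟩
  exact (EReal.coe_le_coe_iff.2 hc.2).trans_lt hb.2

theorem uniqueDiffOn_timeInterval {T : EReal} (hT : 0 < T) :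
    UniqueDiffOn ℝ (timeInterval T) := by
  obtain ⟨t, ht0, htT⟩ := EReal.lt_iff_exists_real_btwn.1 hT
  refine uniqueDiffOn_convex (convex_timeInterval T) ⟨t / 2, ?_⟩
  have ht : (0 : ℝ) < t := by exact_mod_cast ht0
  refine mem_interior.2 ⟨Ioo 0 t, fun s hs => ⟨hs.1.le, ?_⟩, isOpen_Ioo, by linarith, by linarith⟩
  exact (EReal.coe_lt_coe_iff.2 hs.2).trans htT

theorem uniqueDiffOn_Icc_zero_one : UniqueDiffOn ℝ (Icc (0 : ℝ) 1) :=
  uniqueDiffOn_Icc zero_lt_one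

theorem Icc_subset_timeInterval {T : EReal} {S : ℝ} (hS : (S : EReal) < T) :
    Icc 0 S ⊆ timeInterval T :=
  fun _ hs => ⟨hs.1, (EReal.coe_le_coe_iff.2 hs.2).trans_lt hS⟩

section ToMild

variable {K : ℝ → ℝ} {ΦF : ℝ} {q : ℝ → ℝ} {T : EReal} {Q : ℝ → ℝ → ℝ} {N : ℝ → ℝ}

theorem IsClassicalSolution.uniqueDiffOn (h : IsClassicalSolution K ΦF q T Q N) :
    UniqueDiffOn ℝ (timeInterval T ×ˢ Icc (0 : ℝ) 1) :=
  (uniqueDiffOn_timeInterval h.time_pos).prod uniqueDiffOn_Icc_zero_one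

theorem IsClassicalSolution.hasFDerivWithinAt (h : IsClassicalSolution K ΦF q T Q N) {τ η : ℝ}
    (hτ : τ ∈ timeInterval T) (hη : η ∈ Icc (0 : ℝ) 1) :
    HasFDerivWithinAt (fun p : ℝ × ℝ => Q p.1 p.2)
      (fderivWithin ℝ (fun p : ℝ × ℝ => Q p.1 p.2) (timeInterval T ×ˢ Icc 0 1) (τ, η))
      (timeInterval T ×ˢ Icc 0 1) (τ, η) :=
  ((h.contDiffOn.differentiableOn one_ne_zero) (τ, η) ⟨hτ, hη⟩).hasFDerivWithinAt

theorem IsClassicalSolution.hasDerivWithinAt_space (h : IsClassicalSolution K ΦF q T Q N)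
    {τ η : ℝ} (hτ : τ ∈ timeInterval T) (hη : η ∈ Icc (0 : ℝ) 1) :
    HasDerivWithinAt (Q τ) (fderivWithin ℝ (fun p : ℝ × ℝ => Q p.1 p.2)
      (timeInterval T ×ˢ Icc 0 1) (τ, η) (0, 1)) (Icc 0 1) η :=
  (h.hasFDerivWithinAt hτ hη).comp_hasDerivWithinAt (f := fun x => (τ, x)) η
    ((hasDerivWithinAt_const η _ τ).prodMk (hasDerivWithinAt_id η _)) fun _ hx => ⟨hτ, hx⟩

theorem IsClassicalSolution.hasDerivWithinAt_time (h : IsClassicalSolution K ΦF q T Q N)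
    {τ η : ℝ} (hτ : τ ∈ timeInterval T) (hη : η ∈ Icc (0 : ℝ) 1) :
    HasDerivWithinAt (fun s => Q s η) (fderivWithin ℝ (fun p : ℝ × ℝ => Q p.1 p.2)
      (timeInterval T ×ˢ Icc 0 1) (τ, η) (1, 0)) (timeInterval T) τ :=
  (h.hasFDerivWithinAt hτ hη).comp_hasDerivWithinAt (f := fun s => (s, η)) τ
    ((hasDerivWithinAt_id τ _).prodMk (hasDerivWithinAt_const τ _ η)) fun _ hs => ⟨hs, hη⟩

theorem IsClassicalSolution.dSpace_eq (h : IsClassicalSolution K ΦF q T Q N)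
    {τ η : ℝ} (hτ : τ ∈ timeInterval T) (hη : η ∈ Icc (0 : ℝ) 1) :
    dSpace Q τ η = fderivWithin ℝ (fun p : ℝ × ℝ => Q p.1 p.2)
      (timeInterval T ×ˢ Icc 0 1) (τ, η) (0, 1) :=
  (h.hasDerivWithinAt_space hτ hη).derivWithin (uniqueDiffOn_Icc_zero_one η hη)

theorem IsClassicalSolution.dTime_eq (h : IsClassicalSolution K ΦF q T Q N)
    {τ η : ℝ} (hτ : τ ∈ timeInterval T) (hη : η ∈ Icc (0 : ℝ) 1) :
    dTime T Q τ η = fderivWithin ℝ (fun p : ℝ × ℝ => Q p.1 p.2)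
      (timeInterval T ×ˢ Icc 0 1) (τ, η) (1, 0) :=
  (h.hasDerivWithinAt_time hτ hη).derivWithin (uniqueDiffOn_timeInterval h.time_pos τ hτ)

theorem IsClassicalSolution.continuousOn_fderivWithin (h : IsClassicalSolution K ΦF q T Q N)
    (v : ℝ × ℝ) : ContinuousOn (fun p => fderivWithin ℝ (fun p : ℝ × ℝ => Q p.1 p.2)
      (timeInterval T ×ˢ Icc 0 1) p v) (timeInterval T ×ˢ Icc 0 1) :=
  (h.contDiffOn.continuousOn_fderivWithin h.uniqueDiffOn le_rfl).clm_apply continuousOn_const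

theorem IsClassicalSolution.equation_closed (hK : Continuous K)
    (h : IsClassicalSolution K ΦF q T Q N) {τ : ℝ} (hτ : τ ∈ timeInterval T) :
    ∀ η ∈ Icc (0 : ℝ) 1, dTime T Q τ η + dSpace Q τ η = 1 / N τ + K (Q τ η) := by
  have hl : ContinuousOn (fun η : ℝ => (τ, η)) (Icc 0 1) := by fun_prop
  have hm : MapsTo (fun η : ℝ => (τ, η)) (Icc 0 1) (timeInterval T ×ˢ Icc 0 1) :=
    fun _ hη => ⟨hτ, hη⟩
  refine EqOn.of_subset_closure (s := Ioo (0 : ℝ) 1) (h.equation τ hτ) ?_ ?_ Ioo_subset_Icc_self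
    (closure_Ioo zero_ne_one).ge
  · refine (((h.continuousOn_fderivWithin (1, 0)).comp hl hm).add
      ((h.continuousOn_fderivWithin (0, 1)).comp hl hm)).congr fun η hη => ?_
    rw [h.dTime_eq hτ hη, h.dSpace_eq hτ hη]
    rfl
  · exact continuousOn_const.add (hK.comp_continuousOn (h.contDiffOn.continuousOn.comp hl hm))

/-- The equation extends by continuity to `η = 0`, where `Q` vanishes identically in time and so has
no time derivative. -/
theorem IsClassicalSolution.dSpace_zero (hK : Continuous K)
    (h : IsClassicalSolution K ΦF q T Q N) {τ : ℝ} (hτ : τ ∈ timeInterval T) :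
    dSpace Q τ 0 = dSpace Q τ 1 - K ΦF + K 0 := by
  have h0 : (0 : ℝ) ∈ Icc (0 : ℝ) 1 := left_mem_Icc.2 zero_le_one
  have h1 := h.equation_closed hK hτ 0 h0
  have h2 : dTime T Q τ 0 = 0 := by
    rw [dTime, derivWithin_congr (f := fun _ => (0 : ℝ)) (fun s hs => h.boundary s hs)
      (h.boundary τ hτ)]
    simp
  rw [h2, h.rate τ hτ, h.boundary τ hτ, zero_add] at h1
  exact h1

/-- The density of a classical solution, restricted to `[0, S] × [0, 1]` and extended constantly. -/
def density (S : ℝ) (hS : 0 ≤ S) (Q : ℝ → ℝ → ℝ) (τ η : ℝ) : ℝ :=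
  dSpace Q (projIcc 0 S hS τ) (projIcc 0 1 zero_le_one η)

theorem density_eq {S : ℝ} (hS : 0 ≤ S) {τ η : ℝ} (hτ : τ ∈ Icc 0 S) (hη : η ∈ Icc (0 : ℝ) 1) :
    density S hS Q τ η = dSpace Q τ η := by
  rw [density, projIcc_of_mem hS hτ, projIcc_of_mem zero_le_one hη]

theorem IsClassicalSolution.continuous_density (h : IsClassicalSolution K ΦF q T Q N) {S : ℝ}
    (hS : 0 ≤ S) (hST : (S : EReal) < T) : Continuous (Function.uncurry (density S hS Q)) := by
  have hc : ContinuousOn (fun p : ℝ × ℝ => dSpace Q p.1 p.2) (timeInterval T ×ˢ Icc 0 1) :=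
    (h.continuousOn_fderivWithin (0, 1)).congr fun p hp => h.dSpace_eq hp.1 hp.2
  refine hc.comp_continuous
    (f := fun p : ℝ × ℝ => ((projIcc 0 S hS p.1 : ℝ), (projIcc 0 1 zero_le_one p.2 : ℝ)))
    ?_ fun p => ⟨Icc_subset_timeInterval hST (projIcc 0 S hS p.1).2, (projIcc 0 1 zero_le_one p.2).2⟩
  exact (continuous_subtype_val.comp (continuous_projIcc.comp continuous_fst)).prodMk
    (continuous_subtype_val.comp (continuous_projIcc.comp continuous_snd))

theorem IsClassicalSolution.cumul_density (h : IsClassicalSolution K ΦF q T Q N) {S : ℝ}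
    (hS : 0 ≤ S) (hST : (S : EReal) < T) {τ η : ℝ} (hτ : τ ∈ Icc 0 S)
    (hη : η ∈ Icc (0 : ℝ) 1) : cumul (density S hS Q) τ η = Q τ η := by
  have hτ' := Icc_subset_timeInterval hST hτ
  have hd : ∀ x ∈ Icc (0 : ℝ) 1, HasDerivWithinAt (Q τ) (density S hS Q τ x) (Icc 0 1) x :=
    fun x hx => by
      rw [density_eq hS hτ hx, h.dSpace_eq hτ' hx]
      exact h.hasDerivWithinAt_space hτ' hx
  rw [cumul, integral_eq_sub_of_hasDerivAt_of_le hη.1 (f := Q τ)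
    (fun x hx => ((hd x ⟨hx.1, hx.2.trans hη.2⟩).continuousWithinAt).mono
      (Icc_subset_Icc_right hη.2))
    (fun x hx => (hd x ⟨hx.1.le, hx.2.le.trans hη.2⟩).hasDerivAt
      (Icc_mem_nhds hx.1 (hx.2.trans_le hη.2)))
    (((h.continuous_density hS hST).uncurry_left τ).intervalIntegrable _ _),
    h.boundary τ hτ', sub_zero]

/-- `Q` is only `C¹`, so its equation cannot be differentiated in `η`. Instead it is integrated
along a characteristic, and the integral identity is differentiated in the starting point; the rate
does not depend on that point and drops out. -/
theorem IsClassicalSolution.isMild (hK : IsPhaseResponse K ΦF)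
    (h : IsClassicalSolution K ΦF q T Q N) {S : ℝ}
    (hS : 0 ≤ S) (hST : (S : EReal) < T) : IsMild K ΦF S (density S hS Q) := by
  have hw := h.continuous_density hS hST
  have hKc := hK.contDiff.continuous
  have h01 : (0 : ℝ) ∈ Icc (0 : ℝ) 1 := left_mem_Icc.2 zero_le_one
  have h11 : (1 : ℝ) ∈ Icc (0 : ℝ) 1 := right_mem_Icc.2 zero_le_one
  refine ⟨hw, fun τ hτ => ?_, ?_, fun τ x r hτ hr hx hrS hx1 => ?_⟩
  · rw [density_eq hS hτ h01, density_eq hS hτ h11,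
      h.dSpace_zero hKc (Icc_subset_timeInterval hST hτ)]
  · have := h.cumul_density hS hST (left_mem_Icc.2 hS) h11
    rw [h.initial 1 h11, h.initialDatum.at_one] at this
    exact this
  set w := density S hS Q with hwdef
  have hchar : ∀ y, 0 ≤ y → y + r ≤ 1 → cumul w (τ + r) (y + r) - cumul w τ y =
      ∫ s in (0 : ℝ)..r, (w (τ + s) 1 - K ΦF + K (cumul w (τ + s) (y + s))) := by
    intro y hy hyr
    have hmem : ∀ s ∈ Icc 0 r, τ + s ∈ Icc 0 S ∧ y + s ∈ Icc (0 : ℝ) 1 := fun s hs =>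
      ⟨⟨by linarith [hs.1], by linarith [hs.2]⟩, by linarith [hs.1], by linarith [hs.2]⟩
    have hd : ∀ s ∈ Icc 0 r, HasDerivWithinAt (fun s => Q (τ + s) (y + s))
        (w (τ + s) 1 - K ΦF + K (cumul w (τ + s) (y + s))) (Icc 0 r) s := by
      intro s hs
      obtain ⟨hs1, hs2⟩ := hmem s hs
      have hs1' := Icc_subset_timeInterval hST hs1
      have e := (h.hasFDerivWithinAt hs1' hs2).comp_hasDerivWithinAt
        (f := fun s => (τ + s, y + s)) (f' := ((1 : ℝ), (1 : ℝ))) s (s := Icc 0 r)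
        (((hasDerivWithinAt_id s _).const_add τ).prodMk ((hasDerivWithinAt_id s _).const_add y))
        fun s hs => ⟨Icc_subset_timeInterval hST (hmem s hs).1, (hmem s hs).2⟩
      refine e.congr_deriv ?_
      have e2 : ((1 : ℝ), (1 : ℝ)) = (1, 0) + (0, 1) := by simp
      rw [e2, map_add, ← h.dTime_eq hs1' hs2, ← h.dSpace_eq hs1' hs2,
        h.equation_closed hKc hs1' _ hs2, h.rate _ hs1', hwdef, density_eq hS hs1 h11,
        h.cumul_density hS hST hs1 hs2]
    have hc : Continuous fun s => w (τ + s) 1 - K ΦF + K (cumul w (τ + s) (y + s)) :=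
      (((hw.uncurry_right 1).comp (by fun_prop)).sub continuous_const).add (hKc.comp
        ((continuous_cumul hw).comp (f := fun s => (τ + s, y + s)) (by fun_prop)))
    rw [integral_eq_sub_of_hasDerivAt_of_le hr (f := fun s => Q (τ + s) (y + s))
      (fun s hs => (hd s hs).continuousWithinAt)
      (fun s hs => (hd s (Ioo_subset_Icc_self hs)).hasDerivAt (Icc_mem_nhds hs.1 hs.2))
      (hc.intervalIntegrable _ _)]
    obtain ⟨hr1, hr2⟩ := hmem r (right_mem_Icc.2 hr)
    obtain ⟨h01, h02⟩ := hmem 0 (left_mem_Icc.2 hr)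
    rw [add_zero] at h01 h02
    rw [hwdef, h.cumul_density hS hST hr1 hr2, h.cumul_density hS hST h01 h02, add_zero, add_zero]
  have hleft : HasDerivAt (fun e => cumul w (τ + r) (x + e + r) - cumul w τ (x + e))
      (w (τ + r) (x + r) - w τ x) 0 := by
    have e1 : HasDerivAt (fun e : ℝ => x + e + r) 1 0 :=
      ((hasDerivAt_id' (0 : ℝ)).const_add x).add_const r
    have e2 : HasDerivAt (fun e : ℝ => x + e) 1 0 := (hasDerivAt_id' (0 : ℝ)).const_add x
    have d1 := (hasDerivAt_cumul hw (τ + r) (x + 0 + r)).comp (0 : ℝ) e1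
    have d2 := (hasDerivAt_cumul hw τ (x + 0)).comp (0 : ℝ) e2
    have := d1.sub d2
    simp only [add_zero, mul_one] at this
    exact this
  have hright := hasDerivAt_integral_mul (s := fun _ => 1) measurable_const (by simp)
    (G := fun e s => w (τ + s) 1 - K ΦF + K (cumul w (τ + s) (x + e + s)))
    (G' := fun e s => deriv K (cumul w (τ + s) (x + e + s)) * w (τ + s) (x + e + s))
    (fun e => (((hw.uncurry_right 1).comp (by fun_prop)).sub continuous_const).add (hKc.comp
        ((continuous_cumul hw).comp (f := fun s => (τ + s, x + e + s)) (by fun_prop))))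
    ((continuous_source hK.contDiff hw).comp
      (f := fun p : ℝ × ℝ => (τ + p.2, x + p.1 + p.2)) (by fun_prop))
    (fun e s => by
      have e1 : HasDerivAt (fun e : ℝ => x + e + s) 1 e :=
        ((hasDerivAt_id' e).const_add x).add_const s
      have := ((hasDerivAt_of_contDiff_two hK.contDiff _).comp e
        ((hasDerivAt_cumul hw (τ + s) (x + e + s)).comp e e1)).const_add (w (τ + s) 1 - K ΦF)
      rw [mul_one] at this
      exact this) 0 r 0
  simp only [one_mul, add_zero] at hright
  -- Starting points may move only to the right, as far as the characteristic stays in `[0, 1]`;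
  -- one-sided derivatives at `0` suffice to identify the two sides.
  have hε : 0 < 1 - r - x := by linarith
  have hsame := hleft.hasDerivWithinAt (s := Icc 0 (1 - r - x)).congr_of_mem
    (f₁ := fun e => ∫ s in (0 : ℝ)..r, (w (τ + s) 1 - K ΦF + K (cumul w (τ + s) (x + e + s))))
    (fun e he => (hchar (x + e) (by linarith [he.1]) (by linarith [he.2])).symm)
    (left_mem_Icc.2 hε.le)
  exact (uniqueDiffOn_Icc hε 0 (left_mem_Icc.2 hε.le)).eq_deriv _ hsame hright.hasDerivWithinAt

end ToMild

/-! ### From mild to classical solutions -/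

section ToClassical

variable {K : ℝ → ℝ} {ΦF : ℝ} {q : ℝ → ℝ} {T : EReal} {w : ℝ → ℝ → ℝ}

theorem hasFDerivAt_cumul_sub (hw : Continuous (Function.uncurry w)) (τ η : ℝ) :
    HasFDerivAt (fun p : ℝ × ℝ => cumul w p.1 p.2 - cumul w p.1 η)
      (w τ η • ContinuousLinearMap.snd ℝ ℝ ℝ) (τ, η) := by
  rw [hasFDerivAt_iff_isLittleO, Asymptotics.isLittleO_iff]
  intro ε hε
  obtain ⟨δ, hδ, hwδ⟩ := Metric.continuousAt_iff.1 (hw.continuousAt (x := (τ, η))) ε hε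
  filter_upwards [Metric.ball_mem_nhds (τ, η) hδ] with ⟨t, y⟩ hp
  rw [Metric.mem_ball, Prod.dist_eq, max_lt_iff] at hp
  simp only [Real.dist_eq] at hp
  have hi : ∀ a b, IntervalIntegrable (w t) volume a b := fun a b =>
    (hw.uncurry_left t).intervalIntegrable a b
  have e : cumul w t y - cumul w t η - (cumul w τ η - cumul w τ η) -
      (w τ η • ContinuousLinearMap.snd ℝ ℝ ℝ) ((t, y) - (τ, η)) =
      ∫ x in η..y, (w t x - w τ η) := by
    rw [integral_sub (hi _ _) intervalIntegrable_const, cumul, cumul,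
      integral_interval_sub_left (hi _ _) (hi _ _)]
    simp [mul_comm]
  rw [e]
  refine (intervalIntegral.norm_integral_le_of_norm_le_const (C := ε) fun x hx => ?_).trans ?_
  · have hx' : |x - η| ≤ |y - η| := abs_sub_left_of_mem_uIcc (uIoc_subset_uIcc hx)
    have := hwδ (x := (t, x)) (by
      rw [Prod.dist_eq, max_lt_iff]
      exact ⟨hp.1, hx'.trans_lt hp.2⟩)
    rw [Real.dist_eq] at this
    exact this.le
  · refine mul_le_mul_of_nonneg_left ?_ hε.le
    exact le_max_right _ _

/-- Near `(τ, η)` the profile splits into its increment from `η`, which is jointly differentiable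
because `w` is continuous, and its value at the fixed `η`, a function of time only. -/
theorem contDiffOn_cumul {u : ℝ → ℝ → ℝ} {I J : Set ℝ} (hI : UniqueDiffOn ℝ I)
    (hJ : UniqueDiffOn ℝ J) (hw : Continuous (Function.uncurry w))
    (hu : Continuous (Function.uncurry u))
    (h : ∀ τ ∈ I, ∀ η ∈ J, HasDerivWithinAt (fun s => cumul w s η) (u τ η) I τ) :
    ContDiffOn ℝ 1 (fun p : ℝ × ℝ => cumul w p.1 p.2) (I ×ˢ J) := by
  have h01 : (1 : WithTop ℕ∞) = 0 + 1 := by simp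
  rw [h01, contDiffOn_succ_iff_hasFDerivWithinAt_of_uniqueDiffOn (hI.prod hJ)]
  refine ⟨by simp, fun p => w p.1 p.2 • ContinuousLinearMap.snd ℝ ℝ ℝ +
    u p.1 p.2 • ContinuousLinearMap.fst ℝ ℝ ℝ, ?_, ?_⟩
  · rw [contDiffOn_zero]
    exact ((hw.smul continuous_const).add (hu.smul continuous_const)).continuousOn
  · rintro ⟨τ, η⟩ ⟨hτ, hη⟩
    have h1 := (hasFDerivAt_cumul_sub hw τ η).hasFDerivWithinAt (s := I ×ˢ J)
    have h2 := (h τ hτ η hη).comp_hasFDerivWithinAt (τ, η)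
      (hasFDerivAt_fst (𝕜 := ℝ) (p := (τ, η))).hasFDerivWithinAt
      (s := I ×ˢ J) (fun p hp => hp.1)
    have := h1.add h2
    exact this.congr (fun p _ => (sub_add_cancel _ _).symm) (sub_add_cancel _ _).symm

theorem IsInitialDatum.congr {q' : ℝ → ℝ} (h : IsInitialDatum K ΦF q)
    (he : EqOn q' q (Icc 0 1)) : IsInitialDatum K ΦF q' where
  contDiffOn := h.contDiffOn.congr he
  monotoneOn := h.monotoneOn.congr he.symm
  at_zero := by rw [he (left_mem_Icc.2 zero_le_one), h.at_zero]
  at_one := by rw [he (right_mem_Icc.2 zero_le_one), h.at_one]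
  deriv_at_one := by
    rw [derivWithin_congr he (he (right_mem_Icc.2 zero_le_one))]
    exact h.deriv_at_one

theorem monotoneOn_cumul (hw : Continuous (Function.uncurry w)) {τ : ℝ}
    (h : ∀ η ∈ Icc (0 : ℝ) 1, 0 ≤ w τ η) : MonotoneOn (cumul w τ) (Icc 0 1) := by
  refine monotoneOn_of_deriv_nonneg (convex_Icc 0 1)
    (fun η _ => (hasDerivAt_cumul hw τ η).continuousAt.continuousWithinAt)
    (fun η _ => (hasDerivAt_cumul hw τ η).differentiableAt.differentiableWithinAt) fun η hη => ?_
  rw [(hasDerivAt_cumul hw τ η).deriv]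
  exact h η (interior_subset hη)

/-- A mild solution with nonnegative density and positive rate is a classical solution. -/
theorem isClassicalSolution_of_isMild (hK : IsPhaseResponse K ΦF) (hT : 0 < T)
    (hq : IsInitialDatum K ΦF q) (h0 : EqOn (cumul w 0) q (Icc 0 1))
    (hm : ∀ S : ℝ, (S : EReal) < T → IsMild K ΦF S w)
    (hw0 : ∀ τ ∈ timeInterval T, ∀ η ∈ Icc (0 : ℝ) 1, 0 ≤ w τ η)
    (hc0 : ∀ τ ∈ timeInterval T, 0 < w τ 1 - K ΦF) :
    IsClassicalSolution K ΦF q T (cumul w) (fun τ => 1 / (w τ 1 - K ΦF)) := by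
  have hw : Continuous (Function.uncurry w) := (hm 0 hT).continuous
  have hc : Continuous fun τ => w τ 1 - K ΦF := (hw.uncurry_right 1).sub continuous_const
  have hspace : ∀ τ, ∀ η ∈ Icc (0 : ℝ) 1, dSpace (cumul w) τ η = w τ η := fun τ η hη =>
    (hasDerivAt_cumul hw τ η).hasDerivWithinAt.derivWithin (uniqueDiffOn_Icc_zero_one η hη)
  have htime : ∀ τ ∈ timeInterval T, ∀ η ∈ Icc (0 : ℝ) 1,
      HasDerivWithinAt (fun s => cumul w s η) (w τ 1 - K ΦF + K (cumul w τ η) - w τ η)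
        (timeInterval T) τ := by
    intro τ hτ η hη
    -- A horizon strictly beyond `τ` makes `[0, S]` a neighbourhood of `τ` within the time interval.
    obtain ⟨S, hτS, hST⟩ := EReal.lt_iff_exists_real_btwn.1 hτ.2
    have hτS' : τ < S := by exact_mod_cast hτS
    refine ((hm S hST).hasDerivWithinAt_time hK.contDiff ⟨hτ.1, hτS'.le⟩ hη).mono_of_mem_nhdsWithin
      ?_
    filter_upwards [self_mem_nhdsWithin, mem_nhdsWithin_of_mem_nhds (Iio_mem_nhds hτS')] with s h1 h2
    exact ⟨h1.1, h2.le⟩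
  exact
    { time_pos := hT
      initialDatum := hq
      contDiffOn := contDiffOn_cumul (u := fun τ η => w τ 1 - K ΦF + K (cumul w τ η) - w τ η)
        (uniqueDiffOn_timeInterval hT) uniqueDiffOn_Icc_zero_one hw
        (((hc.comp continuous_fst).add
          (hK.contDiff.continuous.comp (continuous_cumul hw))).sub hw) htime
      monotoneOn := fun τ hτ => monotoneOn_cumul hw (hw0 τ hτ)
      rate_continuousOn := continuousOn_const.div hc.continuousOn fun τ hτ => (hc0 τ hτ).ne'
      rate_pos := fun τ hτ => one_div_pos.2 (hc0 τ hτ)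
      equation := fun τ hτ η hη => by
        have hη' := Ioo_subset_Icc_self hη
        rw [hspace τ η hη', dTime, (htime τ hτ η hη').derivWithin
          (uniqueDiffOn_timeInterval hT τ hτ), one_div_one_div]
        ring
      boundary := fun τ _ => integral_same
      rate := fun τ _ => by rw [hspace τ 1 (right_mem_Icc.2 zero_le_one), one_div_one_div]
      initial := h0
      constraint := fun τ hτ => by
        rw [hspace τ 1 (right_mem_Icc.2 zero_le_one)]
        exact sub_pos.1 (hc0 τ hτ) }

end ToClassical

/-! ### The dichotomy between steady states and blow-up -/

section Dichotomy

variable {K : ℝ → ℝ} {ΦF : ℝ} {q : ℝ → ℝ} {T : EReal} {Q : ℝ → ℝ → ℝ} {N : ℝ → ℝ}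

theorem IsPhaseResponse.zero_pos (hK : IsPhaseResponse K ΦF) (hΦF : 0 < ΦF) : 0 < K 0 :=
  hK.pos 0 (left_mem_Icc.2 hΦF.le)

theorem IsClassicalSolution.dSpace_nonneg (h : IsClassicalSolution K ΦF q T Q N) {τ : ℝ}
    (hτ : τ ∈ timeInterval T) (η : ℝ) : 0 ≤ dSpace Q τ η :=
  (h.monotoneOn τ hτ).derivWithin_nonneg

theorem IsClassicalSolution.zero_mem (h : IsClassicalSolution K ΦF q T Q N) :
    (0 : ℝ) ∈ timeInterval T := ⟨le_rfl, h.time_pos⟩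

theorem IsClassicalSolution.dSpace_initial (h : IsClassicalSolution K ΦF q T Q N) {η : ℝ}
    (hη : η ∈ Icc (0 : ℝ) 1) : dSpace Q 0 η = derivWithin q (Icc 0 1) η :=
  derivWithin_congr h.initial (h.initial η hη)

theorem cumul_congr {w₁ w₂ : ℝ → ℝ → ℝ} {τ η : ℝ} (h : EqOn (w₁ τ) (w₂ τ) (Icc 0 1))
    (hη : η ∈ Icc (0 : ℝ) 1) : cumul w₁ τ η = cumul w₂ τ η := by
  refine integral_congr fun x hx => h ?_
  rw [uIcc_of_le hη.1] at hx
  exact ⟨hx.1, hx.2.trans hη.2⟩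

theorem IsClassicalSolution.rate_eq (h : IsClassicalSolution K ΦF q T Q N) {τ : ℝ}
    (hτ : τ ∈ timeInterval T) : N τ = 1 / (dSpace Q τ 1 - K ΦF) := by
  rw [← h.rate τ hτ, one_div_one_div]

/-- Classical solutions coincide with mild solutions with the same initial density. -/
theorem IsClassicalSolution.eqOn_of_isMild (hK : IsPhaseResponse K ΦF)
    (h : IsClassicalSolution K ΦF q T Q N) {S : ℝ} (hST : (S : EReal) < T) {w : ℝ → ℝ → ℝ}
    (hw : IsMild K ΦF S w) (h0 : EqOn (w 0) (derivWithin q (Icc 0 1)) (Icc 0 1)) {τ : ℝ}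
    (hτ : τ ∈ Icc 0 S) :
    EqOn (dSpace Q τ) (w τ) (Icc 0 1) ∧ EqOn (Q τ) (cumul w τ) (Icc 0 1) ∧
      N τ = 1 / (w τ 1 - K ΦF) := by
  have hS : 0 ≤ S := hτ.1.trans hτ.2
  have he : EqOn (density S hS Q τ) (w τ) (Icc 0 1) :=
    (h.isMild hK hS hST).unique hK hw (fun x hx => by
      rw [density_eq hS (left_mem_Icc.2 hS) hx, h.dSpace_initial hx, h0 hx]) hτ
  have hd : EqOn (dSpace Q τ) (w τ) (Icc 0 1) := fun x hx => by
    rw [← he hx, density_eq hS hτ hx]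
  refine ⟨hd, fun x hx => ?_, ?_⟩
  · rw [← h.cumul_density hS hST hτ hx, cumul_congr he hx]
  · rw [h.rate_eq (Icc_subset_timeInterval hST hτ), hd (right_mem_Icc.2 zero_le_one)]

theorem IsMild.nonneg_of_rate_nonneg (hK : IsPhaseResponse K ΦF) (hΦF : 0 < ΦF)
    {S : ℝ} {w : ℝ → ℝ → ℝ} (hw : IsMild K ΦF S w) (h0 : ∀ x ∈ Icc (0 : ℝ) 1, 0 ≤ w 0 x)
    (hc : ∀ τ ∈ Icc 0 S, 0 ≤ w τ 1 - K ΦF) : ∀ τ ∈ Icc 0 S, ∀ x ∈ Icc (0 : ℝ) 1, 0 ≤ w τ x :=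
  hw.nonneg hK.contDiff h0 fun τ hτ => by
    rw [hw.boundary τ hτ]
    linarith [hc τ hτ, hK.zero_pos hΦF]

/-- If a classical solution is not constant in time then the rate of the mild solution with the
same initial density cannot stay positive forever. -/
theorem IsClassicalSolution.exists_rate_nonpos (hK : IsPhaseResponse K ΦF) (hΦF : 0 < ΦF)
    (hk : 0 < kMin K ΦF) (h : IsClassicalSolution K ΦF q T Q N) {a : ℝ} (ha : a ∈ timeInterval T)
    (hne : ¬ EqOn (dSpace Q a) (dSpace Q 0) (Icc 0 1)) :
    ∃ M w, IsMild K ΦF M w ∧ EqOn (w 0) (derivWithin q (Icc 0 1)) (Icc 0 1) ∧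
      ∃ τ ∈ Icc 0 M, w τ 1 - K ΦF ≤ 0 := by
  by_contra! hcon
  set D := density a ha.1 Q with hD
  have hDm : IsMild K ΦF a D := h.isMild hK ha.1 ha.2
  have ha0 : (0 : ℝ) ∈ Icc 0 a := left_mem_Icc.2 ha.1
  have haa : a ∈ Icc 0 a := right_mem_Icc.2 ha.1
  have hD0 : EqOn (D 0) (derivWithin q (Icc 0 1)) (Icc 0 1) := fun x hx => by
    rw [hD, density_eq ha.1 ha0 hx, h.dSpace_initial hx]
  have hDc : Continuous (Function.uncurry fun τ => D (τ + a)) :=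
    hDm.continuous.comp ((continuous_fst.add continuous_const).prodMk continuous_snd)
  set δ := distL1 (fun τ => D (τ + a)) D 0 with hδ
  have hδ0 : 0 < δ := by
    refine lt_of_le_of_ne (distL1_nonneg 0) fun h0 => hne fun x hx => ?_
    have := eqOn_of_distL1_eq_zero hDc hDm.continuous h0.symm hx
    rw [zero_add, hD, density_eq ha.1 haa hx, density_eq ha.1 ha0 hx] at this
    exact this
  -- Since `exp x ≥ 1 + x`, after this time the distance is at least `2 * ΦF + δ`, above the bound
  -- `2 * ΦF` for nonnegative densities of mass `ΦF`.
  set t := 2 * ΦF / (kMin K ΦF * δ) with ht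
  have ht0 : 0 ≤ t := by positivity
  obtain ⟨w, hw, hw0⟩ := exists_isMild hK (hDm.continuous.uncurry_left 0)
    (hDm.boundary 0 ha0) hDm.mass_zero (M := a + t) (add_nonneg ha.1 ht0)
  have hc := hcon (a + t) w hw (hw0.trans hD0)
  have hpos := hw.nonneg_of_rate_nonneg hK hΦF (fun x hx => by
    rw [hw0 hx, hD, density_eq ha.1 ha0 hx]
    exact h.dSpace_nonneg h.zero_mem x) fun τ hτ => (hc τ hτ).le
  have hsame : EqOn (w a) (D a) (Icc 0 1) :=
    (hw.mono (by linarith)).unique hK hDm hw0 haa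
  -- The equation is autonomous, so the solution shifted by `a` is again mild and can be compared
  -- with the unshifted one.
  have hshift := hw.shift hK (a := a) ⟨ha.1, by linarith⟩
  rw [add_sub_cancel_left] at hshift
  have hw' : IsMild K ΦF t w := hw.mono (by linarith [ha.1])
  have htt : t ∈ Icc 0 t := right_mem_Icc.2 ht0
  have hgrow := hshift.distL1_growth hK hw'
    (fun τ hτ x hx => hpos (τ + a) ⟨by linarith [hτ.1, ha.1], by linarith [hτ.2]⟩ x hx)
    (fun τ hτ x hx => hpos τ ⟨hτ.1, by linarith [hτ.2, ha.1]⟩ x hx) htt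
  have hstart : distL1 (fun τ => w (τ + a)) w 0 = δ := by
    refine integral_congr fun x hx => ?_
    rw [uIcc_of_le zero_le_one] at hx
    simp only [zero_add]
    rw [hsame hx, hw0 hx]
  have hend : distL1 (fun τ => w (τ + a)) w t ≤ 2 * ΦF := by
    have hi₁ := (hshift.continuous.uncurry_left t).intervalIntegrable (μ := volume) 0 1
    have hi₂ := (hw.continuous.uncurry_left t).intervalIntegrable (μ := volume) 0 1
    calc distL1 (fun τ => w (τ + a)) w t ≤ ∫ x in (0 : ℝ)..1, (w (t + a) x + w t x) := by
          refine integral_mono_on zero_le_one (hi₁.sub hi₂).abs (hi₁.add hi₂) fun x hx => ?_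
          have h1 := hpos (t + a) ⟨by linarith [ha.1], by linarith⟩ x hx
          have h2 := hpos t ⟨ht0, by linarith [ha.1]⟩ x hx
          rw [abs_le]
          constructor <;> linarith
      _ = ΦF + ΦF := by
          rw [integral_add hi₁ hi₂]
          exact congrArg₂ _ (hshift.mass hK htt) (hw'.mass hK htt)
      _ = 2 * ΦF := by ring
  rw [hstart] at hgrow
  have hexp := mul_le_mul_of_nonneg_left (Real.add_one_le_exp (kMin K ΦF * t)) hδ0.le
  have hkt : δ * (kMin K ΦF * t + 1) = 2 * ΦF + δ := by
    rw [ht]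
    field_simp
  linarith

/-- Differentiating the stationary relation for `p` along `x + r` produces the source term. -/
theorem isMild_const (hK : ContDiff ℝ 2 K) {p : ℝ → ℝ} (hp : Continuous p)
    (hmass : ∫ x in (0 : ℝ)..1, p x = ΦF)
    (heq : ∀ x ∈ Icc (0 : ℝ) 1, p x = p 1 - K ΦF + K (∫ y in (0 : ℝ)..x, p y)) (S : ℝ) :
    IsMild K ΦF S (fun _ => p) where
  continuous := hp.comp continuous_snd
  boundary _ _ := by simpa using heq 0 (left_mem_Icc.2 zero_le_one)
  mass_zero := hmass
  transport τ x h _ hh hx _ hx1 := by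
    have hQ : Continuous fun x => ∫ y in (0 : ℝ)..x, p y :=
      continuous_primitive (fun a b => hp.intervalIntegrable a b) 0
    have hd : ∀ r, HasDerivAt (fun r => K (∫ y in (0 : ℝ)..(x + r), p y))
        (deriv K (∫ y in (0 : ℝ)..(x + r), p y) * p (x + r)) r := fun r => by
      have e : HasDerivAt (fun r : ℝ => x + r) 1 r := (hasDerivAt_id' r).const_add x
      have := (hasDerivAt_of_contDiff_two hK _).comp r
        ((hasDerivAt_primitive hp 0 (x + r)).comp r e)
      rw [mul_one] at this
      exact this
    have hc : Continuous fun r => deriv K (∫ y in (0 : ℝ)..(x + r), p y) * p (x + r) :=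
      ((continuous_deriv_of_contDiff_two hK).comp (hQ.comp (by fun_prop))).mul
        (hp.comp (by fun_prop))
    have := integral_eq_sub_of_hasDerivAt (fun r _ => hd r) (hc.intervalIntegrable 0 h)
    simp only [cumul]
    rw [this, heq (x + h) ⟨by linarith, hx1.le⟩, heq x ⟨hx, by linarith⟩, add_zero]
    ring

/-- A classical solution whose density does not change in time is a steady state. -/
theorem IsClassicalSolution.exists_isSteadyState (hK : IsPhaseResponse K ΦF)
    (h : IsClassicalSolution K ΦF q T Q N)
    (hconst : ∀ a ∈ timeInterval T, EqOn (dSpace Q a) (dSpace Q 0) (Icc 0 1)) :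
    ∃ qs ns, IsSteadyState K ΦF qs ns ∧ AgreeUpTo T Q N (fun _ => qs) (fun _ => ns) := by
  have hm0 := h.isMild hK le_rfl h.time_pos
  set p := density 0 le_rfl Q 0 with hp
  have hpc : Continuous p := hm0.continuous.uncurry_left 0
  have h00 : (0 : ℝ) ∈ Icc (0 : ℝ) 0 := left_mem_Icc.2 le_rfl
  have h11 : (1 : ℝ) ∈ Icc (0 : ℝ) 1 := right_mem_Icc.2 zero_le_one
  have hpe : ∀ x ∈ Icc (0 : ℝ) 1, p x = dSpace Q 0 x := fun x hx => density_eq le_rfl h00 hx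
  have hQ : ∀ τ ∈ timeInterval T, ∀ x ∈ Icc (0 : ℝ) 1, Q τ x = cumul (fun _ => p) 0 x := by
    intro τ hτ x hx
    have hττ : τ ∈ Icc 0 τ := right_mem_Icc.2 hτ.1
    rw [← h.cumul_density hτ.1 hτ.2 hττ hx]
    refine cumul_congr (w₂ := fun _ => p) (fun y hy => ?_) hx
    rw [density_eq hτ.1 hττ hy, hconst τ hτ hy, hpe y hy]
  have heq : ∀ x ∈ Icc (0 : ℝ) 1, p x = p 1 - K ΦF + K (∫ y in (0 : ℝ)..x, p y) := by
    intro x hx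
    have e := h.equation_closed hK.contDiff.continuous h.zero_mem x hx
    have e0 : dTime T Q 0 x = 0 := by
      rw [dTime, derivWithin_congr (f := fun _ => cumul (fun _ => p) 0 x)
        (fun s hs => hQ s hs x hx) (hQ 0 h.zero_mem x hx)]
      simp
    rw [e0, zero_add, h.rate 0 h.zero_mem, hQ 0 h.zero_mem x hx, ← hpe x hx, ← hpe 1 h11] at e
    exact e
  have hc : 0 < p 1 - K ΦF := by
    rw [hpe 1 h11]
    exact sub_pos.2 (h.constraint 0 h.zero_mem)
  have hinit : EqOn (cumul (fun _ => p) 0) q (Icc 0 1) := fun x hx => by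
    rw [← hQ 0 h.zero_mem x hx, h.initial x hx]
  refine ⟨cumul (fun _ => p) 0, 1 / (p 1 - K ΦF), ?_, fun τ hτ => ⟨hQ τ hτ, ?_⟩⟩
  · exact isClassicalSolution_of_isMild (w := fun _ => p) hK EReal.zero_lt_top
      (h.initialDatum.congr hinit) (fun _ _ => rfl)
      (fun S _ => isMild_const hK.contDiff hpc hm0.mass_zero heq S)
      (fun _ _ x hx => (hpe x hx).symm ▸ h.dSpace_nonneg h.zero_mem x) fun _ _ => hc
  · rw [h.rate_eq hτ, hconst τ hτ h11, hpe 1 h11]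

/-- The blow-up time is the first zero of the rate of the mild continuation, which exists by
compactness and is positive because the datum has positive rate. -/
theorem IsClassicalSolution.blowsUp (hK : IsPhaseResponse K ΦF) (hΦF : 0 < ΦF)
    (hk : 0 < kMin K ΦF) (h : IsClassicalSolution K ΦF q T Q N) {a : ℝ} (ha : a ∈ timeInterval T)
    (hne : ¬ EqOn (dSpace Q a) (dSpace Q 0) (Icc 0 1)) :
    BlowsUpInFiniteTime K ΦF q T Q N := by
  obtain ⟨M, w, hw, hw0, τ₁, hτ₁, hcτ₁⟩ := h.exists_rate_nonpos hK hΦF hk ha hne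
  have h11 : (1 : ℝ) ∈ Icc (0 : ℝ) 1 := right_mem_Icc.2 zero_le_one
  have hcc : Continuous fun τ => w τ 1 - K ΦF :=
    (hw.continuous.uncurry_right 1).sub continuous_const
  have hcpt : IsCompact (Icc 0 M ∩ {τ | w τ 1 - K ΦF ≤ 0}) :=
    isCompact_Icc.inter_right (isClosed_le hcc continuous_const)
  obtain ⟨τs, ⟨hτs, hcτs⟩, hleast⟩ := hcpt.exists_isLeast ⟨τ₁, hτ₁, hcτ₁⟩
  have hc0 : 0 < w 0 1 - K ΦF := by
    rw [hw0 h11]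
    exact sub_pos.2 h.initialDatum.deriv_at_one
  have hτs0 : 0 < τs := lt_of_le_of_ne hτs.1 fun e => by
    rw [← e] at hcτs
    exact absurd hcτs (not_le.2 hc0)
  have hcpos : ∀ τ ∈ Ico 0 τs, 0 < w τ 1 - K ΦF := fun τ hτ => by
    by_contra! hle
    exact absurd (hleast ⟨⟨hτ.1, hτ.2.le.trans hτs.2⟩, hle⟩) (not_le.2 hτ.2)
  have hcnn : ∀ τ ∈ Icc 0 τs, 0 ≤ w τ 1 - K ΦF := by
    have : closure (Ico 0 τs) ⊆ {τ | 0 ≤ w τ 1 - K ΦF} :=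
      closure_minimal (fun τ hτ => (hcpos τ hτ).le) (isClosed_le continuous_const hcc)
    rw [closure_Ico hτs0.ne] at this
    exact this
  have hczero : w τs 1 - K ΦF = 0 := le_antisymm hcτs (hcnn τs (right_mem_Icc.2 hτs.1))
  have hws : IsMild K ΦF τs w := hw.mono hτs.2
  have hpos := hws.nonneg_of_rate_nonneg hK hΦF (fun x hx => by
    rw [hw0 hx]
    exact h.initialDatum.monotoneOn.derivWithin_nonneg) hcnn
  have hmem : ∀ τ ∈ timeInterval (τs : EReal), τ ∈ Ico 0 τs := fun τ hτ =>
    ⟨hτ.1, EReal.coe_lt_coe_iff.1 hτ.2⟩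
  have hclass : IsClassicalSolution K ΦF q τs (cumul w) (fun τ => 1 / (w τ 1 - K ΦF)) := by
    refine isClassicalSolution_of_isMild hK (by exact_mod_cast hτs0) h.initialDatum
      (fun x hx => ?_) (fun S hS => hws.mono (EReal.coe_lt_coe_iff.1 hS).le)
      (fun τ hτ => hpos τ (Ico_subset_Icc_self (hmem τ hτ))) fun τ hτ => hcpos τ (hmem τ hτ)
    rw [← (h.eqOn_of_isMild hK h.time_pos (hws.mono hτs.1) hw0 (left_mem_Icc.2 le_rfl)).2.1 hx,
      h.initial x hx]
  have hmax : ∀ (T' : EReal) (Q' : ℝ → ℝ → ℝ) (N' : ℝ → ℝ),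
      IsClassicalSolution K ΦF q T' Q' N' → T' ≤ τs := by
    intro T' Q' N' h'
    by_contra! hlt
    -- A solution living past `τs` would agree there with the mild one, whose rate is zero; the
    -- convention `1 / 0 = 0` then gives `N' τs = 0`, against positivity.
    have hN := (h'.eqOn_of_isMild hK hlt hws hw0 (right_mem_Icc.2 hτs.1)).2.2
    rw [hczero, div_zero] at hN
    exact (h'.rate_pos τs ⟨hτs.1, hlt⟩).ne' hN
  refine ⟨τs, cumul w, fun τ => 1 / (w τ 1 - K ΦF), hmax T Q N h, ⟨hclass, hmax⟩,
    fun τ hτ => ?_, ?_⟩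
  · have hττs : τ ≤ τs := EReal.coe_le_coe_iff.1 (hτ.2.le.trans (hmax T Q N h))
    obtain ⟨-, h2, h3⟩ := h.eqOn_of_isMild hK hτ.2 (hws.mono hττs) hw0 (right_mem_Icc.2 hτ.1)
    exact ⟨h2, h3⟩
  · simp only [one_div]
    refine tendsto_inv_nhdsGT_zero.comp (tendsto_nhdsWithin_iff.2 ⟨?_, ?_⟩)
    · have := hcc.tendsto τs
      simp only [hczero] at this
      exact this.mono_left nhdsWithin_le_nhds
    · filter_upwards [Ioo_mem_nhdsLT hτs0] with τ hτ
      exact hcpos τ (Ioo_subset_Ico_self hτ)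

theorem IsSteadyState.not_blowsUp {qs : ℝ → ℝ} {ns : ℝ} (hs : IsSteadyState K ΦF qs ns)
    (h : IsClassicalSolution K ΦF q T Q N)
    (hagree : AgreeUpTo T Q N (fun _ => qs) (fun _ => ns)) :
    ¬ BlowsUpInFiniteTime K ΦF q T Q N := by
  rintro ⟨τs, Qm, Nm, -, ⟨-, hmax⟩, -, -⟩
  -- The steady profile agrees with `q` on `[0, 1]` only, so it is recast as a global solution with
  -- datum `q`; this contradicts a finite maximal time.
  have hclass : IsClassicalSolution K ΦF q ⊤ (fun _ => qs) (fun _ => ns) :=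
    { hs with
      initialDatum := h.initialDatum
      initial := fun x hx => by
        rw [← h.initial x hx]
        exact ((hagree 0 h.zero_mem).1 x hx).symm }
  exact absurd (hmax ⊤ _ _ hclass) (not_le.2 (EReal.coe_lt_top τs))

/-- The distance of two steady states is constant in time, yet grows by the factor `exp kMin > 1`
over unit time, so it is zero. -/
theorem IsSteadyState.unique (hK : IsPhaseResponse K ΦF) (hk : 0 < kMin K ΦF) {q₁ q₂ : ℝ → ℝ}
    {n₁ n₂ : ℝ} (h₁ : IsSteadyState K ΦF q₁ n₁) (h₂ : IsSteadyState K ΦF q₂ n₂) :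
    EqOn q₁ q₂ (Icc 0 1) ∧ n₁ = n₂ := by
  have h1T : ((1 : ℝ) : EReal) < ⊤ := EReal.coe_lt_top 1
  have h01 : (0 : ℝ) ∈ Icc (0 : ℝ) 1 := left_mem_Icc.2 zero_le_one
  have h11 : (1 : ℝ) ∈ Icc (0 : ℝ) 1 := right_mem_Icc.2 zero_le_one
  have hm₁ := IsClassicalSolution.isMild hK h₁ zero_le_one h1T
  have hm₂ := IsClassicalSolution.isMild hK h₂ zero_le_one h1T
  set w₁ := density 1 zero_le_one (fun _ => q₁) with hw₁
  set w₂ := density 1 zero_le_one (fun _ => q₂) with hw₂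
  have hgrow := hm₁.distL1_growth hK hm₂
    (fun τ hτ x hx => by
      rw [hw₁, density_eq zero_le_one hτ hx]
      exact IsClassicalSolution.dSpace_nonneg h₁ (Icc_subset_timeInterval h1T hτ) x)
    (fun τ hτ x hx => by
      rw [hw₂, density_eq zero_le_one hτ hx]
      exact IsClassicalSolution.dSpace_nonneg h₂ (Icc_subset_timeInterval h1T hτ) x) h11
  have hconst : distL1 w₁ w₂ 1 = distL1 w₁ w₂ 0 := rfl
  have hexp : 1 < Real.exp (kMin K ΦF * 1) := Real.one_lt_exp_iff.2 (by linarith)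
  have hzero : distL1 w₁ w₂ 0 = 0 := by
    refine le_antisymm ?_ (distL1_nonneg 0)
    rw [hconst] at hgrow
    by_contra! hlt
    nlinarith
  have heq := eqOn_of_distL1_eq_zero hm₁.continuous hm₂.continuous hzero
  refine ⟨fun x hx => ?_, ?_⟩
  · have e₁ := IsClassicalSolution.cumul_density h₁ zero_le_one h1T h01 hx
    have e₂ := IsClassicalSolution.cumul_density h₂ zero_le_one h1T h01 hx
    rw [← e₁, ← e₂]
    exact cumul_congr heq hx
  · have e₁ := IsClassicalSolution.rate_eq h₁ (IsClassicalSolution.zero_mem h₁)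
    have e₂ := IsClassicalSolution.rate_eq h₂ (IsClassicalSolution.zero_mem h₂)
    have e := heq h11
    rw [hw₁, hw₂, density_eq zero_le_one h01 h11, density_eq zero_le_one h01 h11] at e
    rw [e₁, e₂, e]

end Dichotomy

end PulseCoupled

end

theorem theorem6p1 (K : ℝ → ℝ) (ΦF : ℝ) (hΦF : 0 < ΦF)
    (hK : PulseCoupled.IsPhaseResponse K ΦF) (hkmin : 0 < PulseCoupled.kMin K ΦF) :
    -- there is at most one steady state
    (∀ (q₁ q₂ : ℝ → ℝ) (n₁ n₂ : ℝ), PulseCoupled.IsSteadyState K ΦF q₁ n₁ →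
      PulseCoupled.IsSteadyState K ΦF q₂ n₂ → Set.EqOn q₁ q₂ (Set.Icc 0 1) ∧ n₁ = n₂) ∧
    -- a classical solution blows up in finite time, except if it is the steady state
    (∀ (q : ℝ → ℝ) (T : EReal) (Q : ℝ → ℝ → ℝ) (N : ℝ → ℝ),
      PulseCoupled.IsClassicalSolution K ΦF q T Q N →
        (PulseCoupled.BlowsUpInFiniteTime K ΦF q T Q N ↔
          ¬ ∃ (qs : ℝ → ℝ) (ns : ℝ), PulseCoupled.IsSteadyState K ΦF qs ns ∧
            PulseCoupled.AgreeUpTo T Q N (fun _ => qs) (fun _ => ns))) := by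
  refine ⟨fun q₁ q₂ n₁ n₂ h₁ h₂ => h₁.unique hK hkmin h₂, fun q T Q N h => ⟨?_, fun hns => ?_⟩⟩
  · rintro hb ⟨qs, ns, hs, hagree⟩
    exact hs.not_blowsUp h hagree hb
  -- The alternative is whether the density ever differs from its initial value.
  · by_cases hconst : ∀ a ∈ PulseCoupled.timeInterval T,
        Set.EqOn (PulseCoupled.dSpace Q a) (PulseCoupled.dSpace Q 0) (Set.Icc 0 1)
    · exact absurd (h.exists_isSteadyState hK hconst) hns
    · push Not at hconst
      obtain ⟨a, ha, hne⟩ := hconst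
      exact h.blowsUp hK hΦF hkmin ha hne
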